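/- **Setting.** Let $k$ be a commutative ring; dg-categories are over $k$, with differentials of degree $+1$. A degree $0$ morphism is *homotopy invertible* if it is closed and becomes an isomorphism in the homotopy category $H^0$. *The dg-category $\Delta_n(\mathcal B)$.* Let $\mathcal B$ be a dg-category. For families $(E_i)$, $(F_i)$, $0\le i\le n$, of objects, a cochain $\theta$ of degree $m$ from $E$ to $F$ is a family $\theta^{q,m-q}_{i_0\ldots i_q}\in\mathrm{Hom}^{m-q}_{\mathcal B}(E_{i_q},F_{i_0})$, for $q\ge 0$ and $0\le i_0\le\dots\le i_q\le n$. Put $$(D\theta)_{i_0\ldots i_q}=(-1)^q d(\theta_{i_0\ldots i_q})+\sum_{j=1}^{q-1}(-1)^j\theta_{i_0\ldots\widehat{i_j}\ldots i_q},\qquad (\theta\cdot\eta)_{i_0\ldots i_q}=\sum_{j=0}^{q}(-1)^{(a-j)(q-j)}\theta_{i_0\ldots i_j}\circ\eta_{i_j\ldots i_q}$$ for $\theta$ of degree $a$. An object of $\Delta_n(\mathcal B)$ is a family $E=(E_i)$ with a degree $1$ cochain $\phi$ from $E$ to $E$ with no components for $q=0$, such that $D\phi+\phi\cdot\phi=0$,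 all $\phi^{1,0}_{ij}$ $(i\le j)$ are homotopy invertible, and (N) $\phi^{1,0}_{ii}=\mathrm{id}$, and $\phi^{q,1-q}_{i_0\ldots i_q}=0$ if $q\ge2$ and an index is repeated. Morphisms from $(E,\phi)$ to $(F,\psi)$ of degree $m$ are the cochains of degree $m$, composed by $\cdot$, with differential $d\theta=D\theta+\psi\cdot\theta-(-1)^m\theta\cdot\phi$. Write $\Delta_n^{\mathrm{un}}(\mathcal B)$ for the variant in which (N) is not required. Both are contravariant in $[n]$ by restriction of indices, and functorial in $\mathcal B$. *Totalization.* For a cosimplicial dg-category $\mathcal B^\bullet$, $\mathrm{Tot}(\mathcal B^\bullet)$ is the equalizer of the two dg-functors $\prod_n\Delta_n(\mathcal B^n)\rightrightarrows\prod_{\sigma:[n]\to[m]}\Delta_n(\mathcal B^m)$ that are induced by $\Delta_n(\sigma_*):\Delta_n(\mathcal B^n)\to\Delta_n(\mathcal B^m)$ and by $\sigma^*:\Delta_m(\mathcal B^m)\to\Delta_n(\mathcal B^m)$. With $\Delta_n^{\mathrm{un}}$ in place of $\Delta_n$ one gets $\mathrm{Tot}^{\mathrm{un}}(\mathcal B^\bullet)$.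 *Rectification.* Let $\mathcal F$ be a dg pseudo-functor on the category $\mathcal S$ of schemes over a base scheme: dg-categories $\mathcal F(X)$, dg-functors $f^*$, and strict natural isomorphisms $\mathrm{id}_X^*\cong\mathrm{id}$ and $f^*g^*\cong(gf)^*$ that satisfy the usual unit and associativity conditions strictly. Its rectification $\widetilde{\mathcal F}:\mathcal S^{op}\to\mathrm{dgCat}$ is the strict functor $\widetilde{\mathcal F}(X)=\mathrm{Fun}_{\mathcal S}(\mathcal S/X,\mathcal F)$: an object $\xi$ consists of objects $\xi(h)\in\mathcal F(Y)$ for all $h:Y\to X$ and of compatible closed degree $0$ strict isomorphisms $\xi(hg)\cong g^*\xi(h)$; morphisms of degree $n$ are natural families of degree $n$ morphisms $\xi(h)\to\eta(h)$; and $f^*$ is composition with $\mathcal S/f$. *Group action.* Let $G$ be a group scheme acting from the right on a scheme $X$ (in $\mathcal S$), and let $[X/G]_\bullet$ be the simplicial scheme with $[X/G]_n=X\times G^n$, with face maps $\partial_0(x,g_1,\ldots,g_n)=(xg_1,g_2,\ldots,g_n)$, $\partial_i(x,g_1,\ldots,g_n)=(x,g_1,\ldots,g_ig_{i+1},\ldots,g_n)$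 for $0<i<n$, $\partial_n(x,g_1,\ldots,g_n)=(x,g_1,\ldots,g_{n-1})$, and degeneracies $s_i(x,g_1,\ldots,g_n)=(x,g_1,\ldots,g_i,e,g_{i+1},\ldots,g_n)$. For $p\le n$ let $\rho_{n,p},\tau_{n,p}:[X/G]_n\to[X/G]_p$ be the front and back face maps $$\rho_{n,p}(x,g_1,\ldots,g_n)=(x,g_1,\ldots,g_p),\qquad \tau_{n,p}(x,g_1,\ldots,g_n)=(xg_1\cdots g_{n-p},g_{n-p+1},\ldots,g_n).$$ **Proposition.** The dg-category $\mathrm{Tot}\,\widetilde{\mathcal F}([X/G]_\bullet)$ is isomorphic to the following one. *Objects:* pairs $(E,\phi)$ of an object $E$ of $\widetilde{\mathcal F}(X)$ and a collection $\phi^{n,1-n}\in\mathrm{Hom}^{1-n}_{\widetilde{\mathcal F}([X/G]_n)}(\tau_{n,0}^*E,\rho_{n,0}^*E)$, $n\ge1$, such that 1. for all $n\ge1$ $$(-1)^n d(\phi^{n,1-n})+\sum_{j=1}^{n-1}(-1)^j\partial_j^*(\phi^{n-1,2-n})+\sum_{j=1}^{n-1}(-1)^{(1-j)(n-j)}\rho_{n,j}^*(\phi^{j,1-j})\circ\tau_{n,n-j}^*(\phi^{n-j,1-n+j})=0;$$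 2. $\phi^{1,0}$ is homotopy invertible; 3. $s_0^*\phi^{1,0}=\mathrm{id}$, and $s_i^*\phi^{n,1-n}=0$ for all $n\ge2$ and $0\le i\le n-1$. *Morphisms* of degree $m$ from $(E,\phi)$ to $(F,\psi)$: collections $\theta^{n,m-n}\in\mathrm{Hom}^{m-n}_{\widetilde{\mathcal F}([X/G]_n)}(\tau_{n,0}^*E,\rho_{n,0}^*F)$, $n\ge0$, with differential $$(d\theta)^{n,m+1-n}=(-1)^n d\theta^{n,m-n}+\sum_{j=1}^{n-1}(-1)^j\partial_j^*\theta^{n-1,m+1-n}+\sum_{l=1}^{n}(-1)^{(1-l)(n-l)}\rho_{n,l}^*\psi^{l,1-l}\circ\tau_{n,n-l}^*\theta^{n-l,m-n+l}-(-1)^m\sum_{l=0}^{n-1}(-1)^{(m-l)(n-l)}\rho_{n,l}^*\theta^{l,m-l}\circ\tau_{n,n-l}^*\phi^{n-l,1-n+l}.$$ *Composition* of $\theta:(E',\phi')\to(E'',\phi'')$ of degree $p$ with $\eta:(E,\phi)\to(E',\phi')$ of degree $q$: $(\theta\eta)^{n,p+q-n}=\sum_{l=0}^n(-1)^{(p-l)(n-l)}\rho_{n,l}^*\theta^{l,p-l}\circ\tau_{n,n-l}^*\eta^{n-l,q-n+l}$;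 the identity has $\mathrm{id}_E$ in simplicial degree $0$ and $0$ elsewhere. The isomorphism sends an object of the totalization with components $(E^n,\phi_n)\in\Delta_n(\widetilde{\mathcal F}([X/G]_n))$ to $E=E^0_0$ and $\phi^{n,1-n}=(\phi_n)_{0\,1\ldots n}$, and a morphism with components $\theta_n$ to $\theta^{n,m-n}=(\theta_n)_{0\,1\ldots n}$; it is $k$-linear on morphisms. The same holds for $\mathrm{Tot}^{\mathrm{un}}\,\widetilde{\mathcal F}([X/G]_\bullet)$ with condition 3 omitted: its objects are exactly the pairs $(E,\phi)$ that satisfy 1 and 2. -/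

import Mathlib

open CategoryTheory

universe w v u v' u' v₁ u₁

/-- A differential graded category over a commutative ring `k`, with cohomological grading.
Degrees of differentials and of composites are tracked by equations between integers. -/
structure DGCat (k : Type w) [CommRing k] where
  Obj : Type u
  Hom : Obj → Obj → ℤ → Type v
  [addCommGroup : ∀ x y n, AddCommGroup (Hom x y n)]
  [module : ∀ x y n, Module k (Hom x y n)]
  d : ∀ {x y : Obj} {n m : ℤ}, n + 1 = m → (Hom x y n →ₗ[k] Hom x y m)
  /-- `comp h f g` is `f ∘ g`. -/
  comp : ∀ {x y z : Obj} {p q n : ℤ}, p + q = n → (Hom y z p →ₗ[k] Hom x y q →ₗ[k] Hom x z n)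
  id : ∀ x : Obj, Hom x x 0
  d_d : ∀ {x y : Obj} {n m l : ℤ} (h : n + 1 = m) (h' : m + 1 = l) (f : Hom x y n),
    d h' (d h f) = 0
  leibniz : ∀ {x y z : Obj} {p p' q q' n m : ℤ} (h : p + q = n) (hn : n + 1 = m)
    (hp : p + 1 = p') (hq : q + 1 = q') (f : Hom y z p) (g : Hom x y q),
    d hn (comp h f g) =
      comp (by omega) (d hp f) g + p.negOnePow • comp (by omega) f (d hq g)
  assoc : ∀ {x y z t : Obj} {p q r a b n : ℤ} (h₁ : p + q = a) (h₂ : a + r = n)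
    (h₃ : q + r = b) (h₄ : p + b = n) (f : Hom z t p) (g : Hom y z q) (e : Hom x y r),
    comp h₂ (comp h₁ f g) e = comp h₄ f (comp h₃ g e)
  id_comp : ∀ {x y : Obj} {n : ℤ} (h : 0 + n = n) (f : Hom x y n), comp h (id y) f = f
  comp_id : ∀ {x y : Obj} {n : ℤ} (h : n + 0 = n) (f : Hom x y n), comp h f (id x) = f

attribute [instance] DGCat.addCommGroup DGCat.module

namespace DGCat

variable {k : Type w} [CommRing k]

/-- Transport of morphisms along equalities of source, target and degree. -/
def castHom (C : DGCat.{w, v, u} k) {x x' y y' : C.Obj} {n n' : ℤ}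
    (hx : x = x') (hy : y = y') (hn : n = n') : C.Hom x y n →ₗ[k] C.Hom x' y' n' := by
  subst hx hy hn
  exact LinearMap.id

/-- A degree `0` morphism is invertible up to homotopy if it is closed and becomes an
isomorphism in the homotopy category `H⁰`. -/
def HomotopyInvertible (C : DGCat.{w, v, u} k) {x y : C.Obj} {n : ℤ} (hn : n = 0)
    (f : C.Hom x y n) : Prop :=
  C.d (m := 1) (by omega) f = 0 ∧ ∃ (g : C.Hom y x 0) (a : C.Hom x x (-1)) (b : C.Hom y y (-1)),
    C.d (m := 1) (by omega) g = 0 ∧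
    C.comp (by omega) g f - C.id x = C.d (by omega) a ∧
    C.comp (by omega) f g - C.id y = C.d (by omega) b

/-- A strict isomorphism: a closed degree `0` morphism with a two-sided inverse. -/
def IsStrictIso (C : DGCat.{w, v, u} k) {x y : C.Obj} (f : C.Hom x y 0) : Prop :=
  C.d (m := 1) (by omega) f = 0 ∧ ∃ g : C.Hom y x 0, C.d (m := 1) (by omega) g = 0 ∧
    C.comp (by omega) g f = C.id x ∧ C.comp (by omega) f g = C.id y

end DGCat

/-- A dg-functor. -/
structure DGFunctor {k : Type w} [CommRing k] (A : DGCat.{w, v, u} k)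
    (B : DGCat.{w, v', u'} k) where
  obj : A.Obj → B.Obj
  map : ∀ {x y : A.Obj} {n : ℤ}, A.Hom x y n →ₗ[k] B.Hom (obj x) (obj y) n
  map_d : ∀ {x y : A.Obj} {n m : ℤ} (h : n + 1 = m) (f : A.Hom x y n),
    map (A.d h f) = B.d h (map f)
  map_comp : ∀ {x y z : A.Obj} {p q n : ℤ} (h : p + q = n) (f : A.Hom y z p) (g : A.Hom x y q),
    map (A.comp h f g) = B.comp h (map f) (map g)
  map_id : ∀ x : A.Obj, map (A.id x) = B.id (obj x)

namespace DGCat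

variable {k : Type w} [CommRing k]

/-- The category of (small) dg-categories and dg-functors. -/
instance : Category (DGCat.{w, v, u} k) where
  Hom A B := DGFunctor A B
  id A :=
    { obj := fun x => x
      map := LinearMap.id
      map_d := fun _ _ => rfl
      map_comp := fun _ _ _ => rfl
      map_id := fun _ => rfl }
  comp F G :=
    { obj := fun x => G.obj (F.obj x)
      map := G.map.comp F.map
      map_d := fun h f => by simp [F.map_d, G.map_d]
      map_comp := fun h f g => by simp [F.map_comp, G.map_comp]
      map_id := fun x => by simp [F.map_id, G.map_id] }

/-- The product of a family of dg-categories. -/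
def pi {ι : Type} (C : ι → DGCat.{w, v, u} k) : DGCat.{w, v, u} k where
  Obj := ∀ i, (C i).Obj
  Hom x y n := ∀ i, (C i).Hom (x i) (y i) n
  d h := LinearMap.pi fun i => ((C i).d h).comp (LinearMap.proj i)
  comp h := LinearMap.mk₂ k (fun f g i => (C i).comp h (f i) (g i))
    (fun _ _ _ => by ext; simp) (fun _ _ _ => by ext; simp)
    (fun _ _ _ => by ext; simp) (fun _ _ _ => by ext; simp)
  id x i := (C i).id (x i)
  d_d h h' f := by ext i; exact (C i).d_d h h' (f i)
  leibniz h hn hp hq f g := by ext i; exact (C i).leibniz h hn hp hq (f i) (g i)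
  assoc h₁ h₂ h₃ h₄ f g e := by ext i; exact (C i).assoc h₁ h₂ h₃ h₄ (f i) (g i) (e i)
  id_comp h f := by ext i; exact (C i).id_comp h (f i)
  comp_id h f := by ext i; exact (C i).comp_id h (f i)

/-- The projections of a product of dg-categories. -/
def piProj {ι : Type} (C : ι → DGCat.{w, v, u} k) (i : ι) : pi C ⟶ C i where
  obj x := x i
  map :=
    { toFun := fun f => f i
      map_add' := fun _ _ => rfl
      map_smul' := fun _ _ => rfl }
  map_d _ _ := rfl
  map_comp _ _ _ := rfl
  map_id _ := rfl

/-- The dg-functor into a product with given components. -/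
def piLift {ι : Type} {A : DGCat.{w, v, u} k} {C : ι → DGCat.{w, v, u} k}
    (F : ∀ i, A ⟶ C i) : A ⟶ pi C where
  obj x i := (F i).obj x
  map := LinearMap.pi fun i => (F i).map
  map_d h f := funext fun i => (F i).map_d h f
  map_comp h f g := funext fun i => (F i).map_comp h f g
  map_id x := funext fun i => (F i).map_id x

section castHom

variable (C : DGCat.{w, v, u} k)

theorem castHom_d {x x' y y' : C.Obj} {n n' m m' : ℤ} (hx : x = x') (hy : y = y')
    (hn : n = n') (hm : m = m') (h : n + 1 = m) (f : C.Hom x y n) :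
    C.castHom hx hy hm (C.d h f) = C.d (by omega) (C.castHom hx hy hn f) := by
  subst hx hy hn hm; rfl

theorem castHom_comp {x x' y y' z z' : C.Obj} {p p' q q' n n' : ℤ} (hx : x = x') (hy : y = y')
    (hz : z = z') (hp : p = p') (hq : q = q') (hn : n = n') (h : p + q = n)
    (f : C.Hom y z p) (g : C.Hom x y q) :
    C.castHom hx hz hn (C.comp h f g) =
      C.comp (by omega) (C.castHom hy hz hp f) (C.castHom hx hy hq g) := by
  subst hx hy hz hp hq hn; rfl

theorem castHom_id {x x' : C.Obj} (hx : x = x') : C.castHom hx hx rfl (C.id x) = C.id x' := by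
  subst hx; rfl

end castHom

/-- The equalizer of two dg-functors: the objects on which they agree, and the morphisms
between those on which they agree. -/
def equalizer {A B : DGCat.{w, v, u} k} (F G : A ⟶ B) : DGCat.{w, v, u} k where
  Obj := {x : A.Obj // F.obj x = G.obj x}
  Hom x y n := LinearMap.eqLocus ((B.castHom x.2 y.2 (rfl : n = n)).comp F.map) G.map
  d {x y n m} h := (A.d h).restrict (by
    intro f hf
    have hf' : B.castHom x.2 y.2 rfl (F.map f) = G.map f := hf
    change B.castHom x.2 y.2 rfl (F.map (A.d h f)) = G.map (A.d h f)
    rw [F.map_d, G.map_d, B.castHom_d x.2 y.2 rfl rfl, hf'])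
  comp {x y z p q n} h := LinearMap.mk₂ k
    (fun f g => ⟨A.comp h f.1 g.1, by
      have hf : B.castHom y.2 z.2 rfl (F.map f.1) = G.map f.1 := f.2
      have hg : B.castHom x.2 y.2 rfl (F.map g.1) = G.map g.1 := g.2
      change B.castHom x.2 z.2 rfl (F.map (A.comp h f.1 g.1)) = G.map (A.comp h f.1 g.1)
      rw [F.map_comp, G.map_comp, B.castHom_comp x.2 y.2 z.2 rfl rfl rfl, hf, hg]⟩)
    (fun _ _ _ => by ext; simp) (fun _ _ _ => by ext; simp)
    (fun _ _ _ => by ext; simp) (fun _ _ _ => by ext; simp)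
  id x := ⟨A.id x.1, by
    change B.castHom x.2 x.2 rfl (F.map (A.id x.1)) = G.map (A.id x.1)
    rw [F.map_id, G.map_id, B.castHom_id]⟩
  d_d h h' f := Subtype.ext (A.d_d h h' f.1)
  leibniz h hn hp hq f g := Subtype.ext (A.leibniz h hn hp hq f.1 g.1)
  assoc h₁ h₂ h₃ h₄ f g e := Subtype.ext (A.assoc h₁ h₂ h₃ h₄ f.1 g.1 e.1)
  id_comp h f := Subtype.ext (A.id_comp h f.1)
  comp_id h f := Subtype.ext (A.comp_id h f.1)

end DGCat

namespace DGCat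

variable {k : Type w} [CommRing k]

section Cochains

variable {B : DGCat.{w, v, u} k} {N : ℕ}

/-- Degree `m` cochains from `E` to `F`: a family of morphisms
`θ_{i₀…i_q} ∈ Hom^{m-q}(E_{i_q}, F_{i₀})` indexed by all multi-indices
`0 ≤ i₀ ≤ … ≤ i_q ≤ N`, that is, all order preserving maps `[q] → [N]`. -/
abbrev Coch (B : DGCat.{w, v, u} k) {N : ℕ} (E F : Fin (N + 1) → B.Obj) (m : ℤ) : Type v :=
  ∀ (q : ℕ) (I : Fin (q + 1) →o Fin (N + 1)), B.Hom (E (I (Fin.last q))) (F (I 0)) (m - q)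

namespace Coch

/-- `s` and `t` are the smallest and the largest element of `A`. -/
def Ends {q : ℕ} (A : Finset (Fin (q + 1))) (s t : Fin (q + 1)) : Prop :=
  s ∈ A ∧ t ∈ A ∧ ∀ x ∈ A, s ≤ x ∧ x ≤ t

theorem Ends.card {q : ℕ} {A : Finset (Fin (q + 1))} {s t : Fin (q + 1)} (h : Ends A s t) :
    A.card = A.card - 1 + 1 := by
  have := Finset.card_pos.2 ⟨s, h.1⟩
  omega

theorem Ends.emb_zero {q : ℕ} {A : Finset (Fin (q + 1))} {s t : Fin (q + 1)} (h : Ends A s t) :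
    A.orderEmbOfFin h.card 0 = s := by
  rw [show (0 : Fin (A.card - 1 + 1)) = ⟨0, by omega⟩ from rfl, Finset.orderEmbOfFin_zero]
  exact le_antisymm (Finset.min'_le _ _ h.1) ((h.2.2 _ (Finset.min'_mem _ _)).1)

theorem Ends.emb_last {q : ℕ} {A : Finset (Fin (q + 1))} {s t : Fin (q + 1)} (h : Ends A s t) :
    A.orderEmbOfFin h.card (Fin.last _) = t := by
  rw [show Fin.last (A.card - 1) = ⟨A.card - 1 + 1 - 1, by omega⟩ from rfl,
    Finset.orderEmbOfFin_last _ (by omega)]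
  exact le_antisymm ((h.2.2 _ (Finset.max'_mem _ _)).2) (Finset.le_max' _ _ h.2.1)

open Classical in
/-- The component of degree `r` of the cochain `θ` at the multi-index which is obtained from
`I = (i₀, …, i_q)` by keeping the entries `i_a` at the places `a ∈ A` only, where `s` is the
smallest and `t` is the largest element of `A`. (The value is `0` if `s` and `t` are not these
elements, or if `r` is not the right degree.) -/
noncomputable def ev {E F : Fin (N + 1) → B.Obj} {m : ℤ} (θ : Coch B E F m) {q : ℕ}
    (I : Fin (q + 1) →o Fin (N + 1)) (A : Finset (Fin (q + 1))) (s t : Fin (q + 1)) (r : ℤ) :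
    B.Hom (E (I t)) (F (I s)) r :=
  if h : Ends A s t ∧ r + A.card = m + 1 then
    B.castHom (by exact congrArg (fun a => E (I a)) h.1.emb_last)
      (by exact congrArg (fun a => F (I a)) h.1.emb_zero) (by have := h.1.card; have := h.2; omega)
      (θ (A.card - 1) (I.comp (A.orderEmbOfFin h.1.card).toOrderHom))
  else 0

/-- The differential `(Dθ)_{i₀…i_q} = (-1)^q d(θ_{i₀…i_q}) + ∑_{0<j<q} (-1)^j θ_{i₀…î_j…i_q}`. -/
noncomputable def diff {E F : Fin (N + 1) → B.Obj} {m m' : ℤ} (h : m + 1 = m')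
    (θ : Coch B E F m) : Coch B E F m' :=
  fun q I => (q : ℤ).negOnePow • B.d (by omega) (θ q I) +
    ∑ j ∈ (Finset.univ.erase 0).erase (Fin.last q),
      ((j : ℕ) : ℤ).negOnePow • θ.ev I (Finset.univ.erase j) 0 (Fin.last q) (m' - q)

/-- The shuffled multiplication
`(θ · η)_{i₀…i_q} = ∑_j (-1)^{(a-j)(q-j)} θ_{i₀…i_j} ∘ η_{i_j…i_q}`, for `θ` of total degree `a`;
here `a - j` is the degree of `θ_{i₀…i_j}` in `B`. -/
noncomputable def mul {E F G : Fin (N + 1) → B.Obj} {a b m : ℤ} (h : a + b = m)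
    (θ : Coch B F G a) (η : Coch B E F b) : Coch B E G m :=
  fun q I => ∑ j : Fin (q + 1), ((a - (j : ℕ)) * ((q : ℤ) - (j : ℕ))).negOnePow •
    B.comp (by omega) (θ.ev I (Finset.Iic j) 0 j (a - (j : ℕ)))
      (η.ev I (Finset.Ici j) j (Fin.last q) (b - ((q : ℤ) - (j : ℕ))))

/-- The unit cochain: `id` in simplicial degree `0`, and `0` elsewhere. -/
def one (E : Fin (N + 1) → B.Obj) : Coch B E E 0
  | 0, I => B.castHom rfl rfl (by simp) (B.id (E (I 0)))
  | _ + 1, _ => 0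

/-! ### The laws of a dg-category -/

section Laws

variable {E F G H : Fin (N + 1) → B.Obj}

theorem cast_apply {m : ℤ} (θ : Coch B E F m) {q q' : ℕ} (hq : q = q')
    (I : Fin (q + 1) →o Fin (N + 1)) (I' : Fin (q' + 1) →o Fin (N + 1))
    (hI : ∀ i : Fin (q + 1), I i = I' (Fin.cast (by omega) i))
    {x : B.Obj} {y : B.Obj} {r : ℤ} (hx hy hr hx' hy' hr') :
    (B.castHom hx hy hr (θ q I) : B.Hom x y r) = B.castHom hx' hy' hr' (θ q' I') := by
  subst hq
  obtain rfl : I = I' := OrderHom.ext _ _ (funext fun i => hI i)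
  rfl

theorem ev_of {m : ℤ} (θ : Coch B E F m) {q l : ℕ} (I : Fin (q + 1) →o Fin (N + 1))
    (e : Fin (l + 1) ↪o Fin (q + 1)) (r : ℤ) (hr : r + l = m) {A s t}
    (hA : A = Finset.univ.map e.toEmbedding) (hs : s = e 0) (ht : t = e (Fin.last l)) :
    θ.ev I A s t r =
      B.castHom (by rw [ht]; rfl) (by rw [hs]; rfl) (by omega) (θ l (I.comp e.toOrderHom)) := by
  have hc : A.card = l + 1 := by simp [hA]
  have hE : Ends A s t := by
    subst hA hs ht
    refine ⟨by simp, by simp, ?_⟩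
    intro x hx
    obtain ⟨i, -, rfl⟩ := Finset.mem_map.1 hx
    exact ⟨e.monotone (Fin.zero_le _), e.monotone (Fin.le_last _)⟩
  rw [ev, dif_pos ⟨hE, by omega⟩]
  refine cast_apply θ (by omega : A.card - 1 = l) _ _ ?_ _ _ _ _ _ _
  intro i
  have := Finset.orderEmbOfFin_unique' (s := A) (k := l + 1) hc (f := e) (by
    intro x; simp [hA])
  change I _ = I (e _)
  rw [this]
  congr 1

theorem ev_univ {m : ℤ} (θ : Coch B E F m) {q : ℕ} (I : Fin (q + 1) →o Fin (N + 1)) :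
    θ.ev I Finset.univ 0 (Fin.last q) (m - q) = θ q I := by
  exact θ.ev_of (l := q) I (OrderIso.refl _).toOrderEmbedding (m - q) (by omega)
    (by ext; simp) rfl rfl

theorem ev_zero_of {m : ℤ} (θ : Coch B E F m) {q : ℕ} (I : Fin (q + 1) →o Fin (N + 1))
    {A s t r} (h : ¬ (Ends A s t ∧ r + A.card = m + 1)) : θ.ev I A s t r = 0 := dif_neg h

theorem ev_comp_emb {m : ℤ} (θ : Coch B E F m) {q l : ℕ} (I : Fin (q + 1) →o Fin (N + 1))
    (e : Fin (l + 1) ↪o Fin (q + 1)) (A : Finset (Fin (l + 1))) (s t : Fin (l + 1)) (r : ℤ) :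
    θ.ev (I.comp e.toOrderHom) A s t r = θ.ev I (A.map e.toEmbedding) (e s) (e t) r := by
  have key : Ends (A.map e.toEmbedding) (e s) (e t) ↔ Ends A s t := by
    simp [Ends]
  by_cases h : Ends A s t ∧ r + A.card = m + 1
  · have hc := h.1.card
    rw [θ.ev_of (l := A.card - 1) I ((A.orderEmbOfFin hc).trans e) r (by omega) (by
        ext x
        simp only [Finset.mem_map, Finset.mem_univ, true_and]
        constructor
        · rintro ⟨y, hy, rfl⟩
          have : y ∈ Set.range (A.orderEmbOfFin hc) := by
            rw [Finset.range_orderEmbOfFin]; exact hy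
          obtain ⟨i, rfl⟩ := this
          exact ⟨i, rfl⟩
        · rintro ⟨i, rfl⟩
          exact ⟨_, Finset.orderEmbOfFin_mem A hc i, rfl⟩)
      (by simp [h.1.emb_zero]) (by simp [h.1.emb_last])]
    rw [ev, dif_pos h]
    rfl
  · have h' : θ.ev I (A.map e.toEmbedding) (e s) (e t) r = 0 :=
      ev_zero_of _ _ (by rwa [key, Finset.card_map])
    exact (ev_zero_of _ _ h).trans h'.symm

theorem Ends.exists_emb {q : ℕ} {A : Finset (Fin (q + 1))} {s t : Fin (q + 1)} (h : Ends A s t) :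
    ∃ (l : ℕ) (e : Fin (l + 1) ↪o Fin (q + 1)),
      A = Finset.univ.map e.toEmbedding ∧ s = e 0 ∧ t = e (Fin.last l) := by
  refine ⟨A.card - 1, A.orderEmbOfFin h.card, ?_, h.emb_zero.symm, h.emb_last.symm⟩
  apply Finset.coe_injective
  rw [Finset.coe_map, Finset.coe_univ, Set.image_univ]
  exact (Finset.range_orderEmbOfFin A h.card).symm

theorem comp_ev_congr {a b : ℤ} (θ : Coch B F G a) (η : Coch B E F b) {q : ℕ}
    (I : Fin (q + 1) →o Fin (N + 1)) {A₁ A₁' A₂ A₂' : Finset (Fin (q + 1))}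
    {s j t : Fin (q + 1)} {r₁ r₁' r₂ r₂' r : ℤ} (hA₁ : A₁ = A₁') (hA₂ : A₂ = A₂')
    (h₁ : r₁ = r₁') (h₂ : r₂ = r₂') (h : r₁ + r₂ = r) :
    B.comp h (θ.ev I A₁ s j r₁) (η.ev I A₂ j t r₂) =
      B.comp (by omega) (θ.ev I A₁' s j r₁') (η.ev I A₂' j t r₂') := by
  subst hA₁ hA₂ h₁ h₂; rfl

theorem ev_mul {a b m : ℤ} (h : a + b = m) (θ : Coch B F G a) (η : Coch B E F b) {q : ℕ}
    (I : Fin (q + 1) →o Fin (N + 1)) {A : Finset (Fin (q + 1))} {s t : Fin (q + 1)} {r : ℤ}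
    (hA : Ends A s t) (hr : r + A.card = m + 1) :
    (mul h θ η).ev I A s t r = ∑ j ∈ A,
      ((a + 1 - (A.filter (· ≤ j)).card) * ((A.filter (j ≤ ·)).card - 1)).negOnePow •
      B.comp (by omega) (θ.ev I (A.filter (· ≤ j)) s j (a + 1 - (A.filter (· ≤ j)).card))
        (η.ev I (A.filter (j ≤ ·)) j t (r - (a + 1 - (A.filter (· ≤ j)).card))) := by
  obtain ⟨l, e, rfl, rfl, rfl⟩ := hA.exists_emb
  simp only [Finset.card_map, Finset.card_univ, Fintype.card_fin, Nat.cast_add, Nat.cast_one] at hr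
  obtain rfl : r = m - l := by omega
  have h1 := (mul h θ η).ev_comp_emb I e Finset.univ 0 (Fin.last l) (m - l)
  rw [← h1]
  refine (ev_univ _ _).trans ?_
  rw [Finset.sum_map]
  refine Finset.sum_congr rfl fun i _ => ?_
  have e1 : (Finset.univ.map e.toEmbedding).filter (· ≤ e i) =
      (Finset.Iic i).map e.toEmbedding := by
    ext x; simp only [Finset.mem_filter, Finset.mem_map, Finset.mem_univ, true_and,
      Finset.mem_Iic]
    constructor
    · rintro ⟨⟨y, rfl⟩, hy⟩; exact ⟨y, by simpa using hy, rfl⟩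
    · rintro ⟨y, hy, rfl⟩; exact ⟨⟨y, rfl⟩, by simpa using hy⟩
  have e2 : (Finset.univ.map e.toEmbedding).filter (e i ≤ ·) =
      (Finset.Ici i).map e.toEmbedding := by
    ext x; simp only [Finset.mem_filter, Finset.mem_map, Finset.mem_univ, true_and,
      Finset.mem_Ici]
    constructor
    · rintro ⟨⟨y, rfl⟩, hy⟩; exact ⟨y, by simpa using hy, rfl⟩
    · rintro ⟨y, hy, rfl⟩; exact ⟨⟨y, rfl⟩, by simpa using hy⟩
  have c1 : (((Finset.univ.map e.toEmbedding).filter (· ≤ e i)).card : ℤ) = i + 1 := by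
    rw [e1, Finset.card_map, Fin.card_Iic]; push_cast; rfl
  have c2 : (((Finset.univ.map e.toEmbedding).filter (e i ≤ ·)).card : ℤ) = l + 1 - i := by
    rw [e2, Finset.card_map, Fin.card_Ici]; have := i.2; omega
  refine congrArg₂ (· • ·) ?_ ?_
  · change _ = ((a + 1 - (((Finset.univ.map e.toEmbedding).filter (· ≤ e i)).card : ℤ)) *
      ((((Finset.univ.map e.toEmbedding).filter (e i ≤ ·)).card : ℤ) - 1)).negOnePow
    rw [c1, c2]; congr 1; ring
  · have t1 := θ.ev_comp_emb I e (Finset.Iic i) 0 i (a - i)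
    have t2 := η.ev_comp_emb I e (Finset.Ici i) i (Fin.last l) (b - (l - i))
    refine (congrArg₂ (fun x y => B.comp _ x y) t1 t2).trans ?_
    refine comp_ev_congr θ η I e1.symm e2.symm ?_ ?_ _
    · change _ = a + 1 - (((Finset.univ.map e.toEmbedding).filter (· ≤ e i)).card : ℤ)
      rw [c1]; ring
    · change _ = m - l - (a + 1 - (((Finset.univ.map e.toEmbedding).filter (· ≤ e i)).card : ℤ))
      rw [c1, ← h]; ring

theorem d_ev_congr {m : ℤ} (θ : Coch B E F m) {q : ℕ}
    (I : Fin (q + 1) →o Fin (N + 1)) {A : Finset (Fin (q + 1))}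
    {s t : Fin (q + 1)} {r r' r₁ : ℤ} (h : r = r') (h' : r + 1 = r₁) :
    B.d h' (θ.ev I A s t r) = B.d (by omega) (θ.ev I A s t r') := by
  subst h; rfl

theorem ev_diff {m m' : ℤ} (h : m + 1 = m') (θ : Coch B E F m) {q : ℕ}
    (I : Fin (q + 1) →o Fin (N + 1)) {A : Finset (Fin (q + 1))} {s t : Fin (q + 1)} {r : ℤ}
    (hA : Ends A s t) (hr : r + A.card = m' + 1) :
    (diff h θ).ev I A s t r =
      ((A.card : ℤ) - 1).negOnePow • B.d (by omega) (θ.ev I A s t (r - 1)) +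
      ∑ j ∈ (A.erase s).erase t, ((A.filter (· < j)).card : ℤ).negOnePow •
        θ.ev I (A.erase j) s t r := by
  obtain ⟨l, e, rfl, rfl, rfl⟩ := hA.exists_emb
  simp only [Finset.card_map, Finset.card_univ, Fintype.card_fin, Nat.cast_add, Nat.cast_one] at hr
  obtain rfl : r = m' - l := by omega
  have h1 := (diff h θ).ev_comp_emb I e Finset.univ 0 (Fin.last l) (m' - l)
  rw [← h1]
  refine (ev_univ _ _).trans ?_
  refine congrArg₂ (· + ·) ?_ ?_
  · refine congrArg₂ (· • ·) ?_ ?_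
    · simp
    · have t1 := θ.ev_comp_emb I e Finset.univ 0 (Fin.last l) (m - l)
      refine (congrArg (B.d _) ((ev_univ θ _).symm.trans t1)).trans ?_
      exact d_ev_congr θ I (by omega) _
  · have hset : ((Finset.univ.map e.toEmbedding).erase (e 0)).erase (e (Fin.last l)) =
        ((Finset.univ.erase 0).erase (Fin.last l)).map e.toEmbedding := by
      rw [Finset.map_erase, Finset.map_erase]; rfl
    rw [hset, Finset.sum_map]
    refine Finset.sum_congr rfl fun i _ => ?_
    refine congrArg₂ (· • ·) ?_ ?_
    · have : (Finset.univ.map e.toEmbedding).filter (· < e.toEmbedding i) =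
          (Finset.Iio i).map e.toEmbedding := by
        ext x; simp only [Finset.mem_filter, Finset.mem_map, Finset.mem_univ, true_and,
          Finset.mem_Iio]
        constructor
        · rintro ⟨⟨y, rfl⟩, hy⟩; exact ⟨y, by simpa using hy, rfl⟩
        · rintro ⟨y, hy, rfl⟩; exact ⟨⟨y, rfl⟩, by simpa using hy⟩
      rw [this, Finset.card_map, Fin.card_Iio]
    · have t1 := θ.ev_comp_emb I e (Finset.univ.erase i) 0 (Fin.last l) (m' - l)
      refine t1.trans ?_
      rw [Finset.map_erase]

theorem comp_negOnePow_left {x y z : B.Obj} {p p' n : ℤ} (h : p + p' = n) (c : ℤ)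
    (f : B.Hom y z p) (g : B.Hom x y p') :
    B.comp h (c.negOnePow • f) g = c.negOnePow • B.comp h f g := by
  simp [Units.smul_def]

theorem comp_negOnePow_right {x y z : B.Obj} {p p' n : ℤ} (h : p + p' = n) (c : ℤ)
    (f : B.Hom y z p) (g : B.Hom x y p') :
    B.comp h f (c.negOnePow • g) = c.negOnePow • B.comp h f g := by
  simp [Units.smul_def]

theorem d_negOnePow {x y : B.Obj} {p n : ℤ} (h : p + 1 = n) (c : ℤ)
    (f : B.Hom x y p) :
    B.d h (c.negOnePow • f) = c.negOnePow • B.d h f := by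
  simp [Units.smul_def]

theorem ends_Iic {q : ℕ} (j : Fin (q + 1)) : Ends (Finset.Iic j) 0 j :=
  ⟨by simp, by simp, fun x hx => ⟨Fin.zero_le _, by simpa using hx⟩⟩

theorem ends_Ici {q : ℕ} (j : Fin (q + 1)) : Ends (Finset.Ici j) j (Fin.last q) :=
  ⟨by simp, by simpa using Fin.le_last j, fun x hx => ⟨by simpa using hx, Fin.le_last _⟩⟩

theorem ev_mul_Iic {a b m : ℤ} (h : a + b = m) (θ : Coch B F G a) (η : Coch B E F b) {q : ℕ}
    (I : Fin (q + 1) →o Fin (N + 1)) (j : Fin (q + 1)) :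
    (mul h θ η).ev I (Finset.Iic j) 0 j (m - (j : ℕ)) = ∑ i ∈ Finset.Iic j,
      ((a - (i : ℕ)) * ((j : ℕ) - (i : ℕ))).negOnePow •
      B.comp (by omega) (θ.ev I (Finset.Iic i) 0 i (a - (i : ℕ)))
        (η.ev I (Finset.Icc i j) i j (b - ((j : ℕ) - (i : ℕ)))) := by
  rw [ev_mul h θ η I (ends_Iic j) (by rw [Fin.card_Iic]; push_cast; ring)]
  refine Finset.sum_congr rfl fun i hi => ?_
  have hij : i ≤ j := by simpa using hi
  have hij' : (i : ℕ) ≤ j := hij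
  have e1 : (Finset.Iic j).filter (· ≤ i) = Finset.Iic i := by
    ext x; simp only [Finset.mem_filter, Finset.mem_Iic]
    exact ⟨fun h => h.2, fun h => ⟨h.trans hij, h⟩⟩
  have e2 : (Finset.Iic j).filter (i ≤ ·) = Finset.Icc i j := by
    ext x; simp only [Finset.mem_filter, Finset.mem_Iic, Finset.mem_Icc]; tauto
  refine congrArg₂ (· • ·) ?_ (comp_ev_congr θ η I e1 e2 ?_ ?_ _)
  · rw [e1, e2, Fin.card_Iic, Fin.card_Icc]; congr 1; push_cast [Nat.cast_sub (by omega : (i : ℕ) ≤ (j : ℕ) + 1)]; ring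
  · rw [e1, Fin.card_Iic]; push_cast; ring
  · rw [e1, Fin.card_Iic]; push_cast; rw [← h]; ring

theorem ev_mul_Ici {a b m : ℤ} (h : a + b = m) (θ : Coch B F G a) (η : Coch B E F b) {q : ℕ}
    (I : Fin (q + 1) →o Fin (N + 1)) (i : Fin (q + 1)) :
    (mul h θ η).ev I (Finset.Ici i) i (Fin.last q) (m - ((q : ℤ) - (i : ℕ))) =
      ∑ j ∈ Finset.Ici i,
      ((a - ((j : ℕ) - (i : ℕ))) * ((q : ℤ) - (j : ℕ))).negOnePow •
      B.comp (by omega) (θ.ev I (Finset.Icc i j) i j (a - ((j : ℕ) - (i : ℕ))))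
        (η.ev I (Finset.Ici j) j (Fin.last q) (b - ((q : ℤ) - (j : ℕ)))) := by
  have hi := i.2
  rw [ev_mul h θ η I (ends_Ici i) (by rw [Fin.card_Ici]; omega)]
  refine Finset.sum_congr rfl fun j hj => ?_
  have hij : i ≤ j := by simpa using hj
  have hij' : (i : ℕ) ≤ j := hij
  have hj := j.2
  have e1 : (Finset.Ici i).filter (· ≤ j) = Finset.Icc i j := by
    ext x; simp only [Finset.mem_filter, Finset.mem_Ici, Finset.mem_Icc]
  have e2 : (Finset.Ici i).filter (j ≤ ·) = Finset.Ici j := by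
    ext x; simp only [Finset.mem_filter, Finset.mem_Ici]
    exact ⟨fun h => h.2, fun h => ⟨hij.trans h, h⟩⟩
  refine congrArg₂ (· • ·) ?_ (comp_ev_congr θ η I e1 e2 ?_ ?_ _)
  · rw [e1, e2, Fin.card_Ici, Fin.card_Icc]; congr 1
    push_cast [Nat.cast_sub (by omega : (i : ℕ) ≤ (j : ℕ) + 1),
      Nat.cast_sub (by omega : (j : ℕ) ≤ q + 1)]; ring
  · rw [e1, Fin.card_Icc]; push_cast [Nat.cast_sub (by omega : (i : ℕ) ≤ (j : ℕ) + 1)]; ring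
  · rw [e1, Fin.card_Icc]; push_cast [Nat.cast_sub (by omega : (i : ℕ) ≤ (j : ℕ) + 1)]
    rw [← h]; ring

theorem mul_assoc {a b c ab bc m : ℤ} (h₁ : a + b = ab) (h₂ : ab + c = m) (h₃ : b + c = bc)
    (h₄ : a + bc = m) (θ : Coch B G H a) (η : Coch B F G b) (ζ : Coch B E F c) :
    mul h₂ (mul h₁ θ η) ζ = mul h₄ θ (mul h₃ η ζ) := by
  funext q I
  have L : ∀ j : Fin (q + 1), ∀ hh, B.comp (n := m - q) hh
      ((mul h₁ θ η).ev I (Finset.Iic j) 0 j (ab - (j : ℕ)))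
      (ζ.ev I (Finset.Ici j) j (Fin.last q) (c - ((q : ℤ) - (j : ℕ)))) =
      ∑ i ∈ Finset.Iic j, ((a - (i : ℕ)) * ((j : ℕ) - (i : ℕ))).negOnePow •
        B.comp hh (B.comp (by omega) (θ.ev I (Finset.Iic i) 0 i (a - (i : ℕ)))
          (η.ev I (Finset.Icc i j) i j (b - ((j : ℕ) - (i : ℕ)))))
          (ζ.ev I (Finset.Ici j) j (Fin.last q) (c - ((q : ℤ) - (j : ℕ)))) := by
    intro j hh
    rw [ev_mul_Iic, map_sum, LinearMap.sum_apply]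
    exact Finset.sum_congr rfl fun i _ => comp_negOnePow_left _ _ _ _
  have R : ∀ i : Fin (q + 1), ∀ hh, B.comp (n := m - q) hh
      (θ.ev I (Finset.Iic i) 0 i (a - (i : ℕ)))
      ((mul h₃ η ζ).ev I (Finset.Ici i) i (Fin.last q) (bc - ((q : ℤ) - (i : ℕ)))) =
      ∑ j ∈ Finset.Ici i, ((b - ((j : ℕ) - (i : ℕ))) * ((q : ℤ) - (j : ℕ))).negOnePow •
        B.comp hh (θ.ev I (Finset.Iic i) 0 i (a - (i : ℕ))) (B.comp (by omega)
          (η.ev I (Finset.Icc i j) i j (b - ((j : ℕ) - (i : ℕ))))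
          (ζ.ev I (Finset.Ici j) j (Fin.last q) (c - ((q : ℤ) - (j : ℕ))))) := by
    intro j hh
    rw [ev_mul_Ici, map_sum]
    exact Finset.sum_congr rfl fun i _ => comp_negOnePow_right _ _ _ _
  change ∑ j : Fin (q + 1), _ = ∑ i : Fin (q + 1), _
  simp only [L, R, Finset.smul_sum, smul_smul, ← Int.negOnePow_add]
  rw [Finset.sum_comm' (t' := Finset.univ) (s' := fun i => Finset.Ici i) (by simp)]
  refine Finset.sum_congr rfl fun i _ => Finset.sum_congr rfl fun j _ => ?_
  refine congrArg₂ (· • ·) ?_ (B.assoc _ _ _ _ _ _ _)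
  congr 1
  rw [← h₁]; ring

theorem ends_erase {q : ℕ} {i : Fin (q + 1)} (h0 : i ≠ 0) (hl : i ≠ Fin.last q) :
    Ends (Finset.univ.erase i) 0 (Fin.last q) :=
  ⟨by simpa using h0.symm, by simpa using hl.symm, fun x _ => ⟨Fin.zero_le _, Fin.le_last _⟩⟩

theorem ev_mul_erase {a b m r : ℤ} (h : a + b = m) (θ : Coch B F G a) (η : Coch B E F b) {q : ℕ}
    (I : Fin (q + 1) →o Fin (N + 1)) {i : Fin (q + 1)} (h0 : i ≠ 0) (hl : i ≠ Fin.last q)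
    (hr : r + q = m + 1) :
    (mul h θ η).ev I (Finset.univ.erase i) 0 (Fin.last q) r =
      (∑ j ∈ Finset.Ioi i, ((a + 1 - (j : ℕ)) * ((q : ℤ) - (j : ℕ))).negOnePow •
        B.comp (by omega) (θ.ev I ((Finset.Iic j).erase i) 0 j (a + 1 - (j : ℕ)))
          (η.ev I (Finset.Ici j) j (Fin.last q) (b - ((q : ℤ) - (j : ℕ))))) +
      ∑ j ∈ Finset.Iio i, ((a - (j : ℕ)) * ((q : ℤ) - (j : ℕ) - 1)).negOnePow •
        B.comp (by omega) (θ.ev I (Finset.Iic j) 0 j (a - (j : ℕ)))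
          (η.ev I ((Finset.Ici j).erase i) j (Fin.last q) (b + 1 - ((q : ℤ) - (j : ℕ)))) := by
  have hi := i.2
  rw [ev_mul h θ η I (ends_erase h0 hl) (by
    rw [Finset.card_erase_of_mem (Finset.mem_univ _), Finset.card_univ, Fintype.card_fin]; omega)]
  have hset : (Finset.univ.erase i) = (Finset.Ioi i).disjUnion (Finset.Iio i) (by
      rw [Finset.disjoint_left]; intro x hx hx'
      exact lt_asymm (Finset.mem_Ioi.1 hx) (Finset.mem_Iio.1 hx')) := by
    ext x
    simp only [Finset.mem_erase, Finset.mem_univ, and_true, Finset.mem_disjUnion, Finset.mem_Ioi,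
      Finset.mem_Iio]
    rw [ne_iff_lt_or_gt, or_comm]
  conv_lhs => rw [Finset.sum_congr hset (fun _ _ => rfl)]
  rw [Finset.sum_disjUnion]
  refine congrArg₂ (· + ·) (Finset.sum_congr rfl fun j hj => ?_)
    (Finset.sum_congr rfl fun j hj => ?_)
  · have hij : i < j := Finset.mem_Ioi.1 hj
    have hij' : (i : ℕ) < j := hij
    have hj2 := j.2
    have e1 : (Finset.univ.erase i).filter (· ≤ j) = (Finset.Iic j).erase i := by
      ext x; simp
    have e2 : (Finset.univ.erase i).filter (j ≤ ·) = Finset.Ici j := by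
      ext x; simp only [Finset.mem_filter, Finset.mem_erase, Finset.mem_univ, Finset.mem_Ici]
      exact ⟨fun h => h.2, fun h => ⟨⟨(hij.trans_le h).ne', trivial⟩, h⟩⟩
    have c1 : (((Finset.univ.erase i).filter (· ≤ j)).card : ℤ) = (j : ℕ) := by
      rw [e1, Finset.card_erase_of_mem (by simpa using hij.le), Fin.card_Iic]; simp
    have c2 : (((Finset.univ.erase i).filter (j ≤ ·)).card : ℤ) = q + 1 - (j : ℕ) := by
      rw [e2, Fin.card_Ici]; omega
    refine congrArg₂ (· • ·) ?_ (comp_ev_congr θ η I e1 e2 ?_ ?_ _)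
    · rw [c1, c2]; congr 1; ring
    · rw [c1]
    · rw [c1]; omega
  · have hij : j < i := Finset.mem_Iio.1 hj
    have hij' : (j : ℕ) < i := hij
    have e1 : (Finset.univ.erase i).filter (· ≤ j) = Finset.Iic j := by
      ext x; simp only [Finset.mem_filter, Finset.mem_erase, Finset.mem_univ, Finset.mem_Iic]
      exact ⟨fun h => h.2, fun h => ⟨⟨(h.trans_lt hij).ne, trivial⟩, h⟩⟩
    have e2 : (Finset.univ.erase i).filter (j ≤ ·) = (Finset.Ici j).erase i := by
      ext x; simp
    have c1 : (((Finset.univ.erase i).filter (· ≤ j)).card : ℤ) = (j : ℕ) + 1 := by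
      rw [e1, Fin.card_Iic]; simp
    have c2 : (((Finset.univ.erase i).filter (j ≤ ·)).card : ℤ) = q - (j : ℕ) := by
      rw [e2, Finset.card_erase_of_mem (by simpa using hij.le), Fin.card_Ici]; omega
    refine congrArg₂ (· • ·) ?_ (comp_ev_congr θ η I e1 e2 ?_ ?_ _)
    · rw [c1, c2]; congr 1; ring
    · rw [c1]; ring
    · rw [c1]; omega

theorem ev_diff_Iic {m m' : ℤ} (h : m + 1 = m') (θ : Coch B E F m) {q : ℕ}
    (I : Fin (q + 1) →o Fin (N + 1)) (j : Fin (q + 1)) {r : ℤ} (hr : r + (j : ℕ) = m') :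
    (diff h θ).ev I (Finset.Iic j) 0 j r =
      ((j : ℕ) : ℤ).negOnePow • B.d (by omega) (θ.ev I (Finset.Iic j) 0 j (m - (j : ℕ))) +
      ∑ i ∈ ((Finset.Iic j).erase 0).erase j, ((i : ℕ) : ℤ).negOnePow •
        θ.ev I ((Finset.Iic j).erase i) 0 j r := by
  rw [ev_diff h θ I (ends_Iic j) (by rw [Fin.card_Iic]; push_cast; omega)]
  refine congrArg₂ (· + ·) ?_ (Finset.sum_congr rfl fun i hi => ?_)
  · refine congrArg₂ (· • ·) (by rw [Fin.card_Iic]; simp) (d_ev_congr θ I (by omega) _)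
  · have hij : i ≤ j := by
      simp only [Finset.mem_erase, Finset.mem_Iic] at hi; exact hi.2.2
    have : (Finset.Iic j).filter (· < i) = Finset.Iio i := by
      ext x; simp only [Finset.mem_filter, Finset.mem_Iic, Finset.mem_Iio]
      exact ⟨fun h => h.2, fun h => ⟨h.le.trans hij, h⟩⟩
    rw [this, Fin.card_Iio]

theorem ev_diff_Ici {m m' : ℤ} (h : m + 1 = m') (θ : Coch B E F m) {q : ℕ}
    (I : Fin (q + 1) →o Fin (N + 1)) (j : Fin (q + 1)) {r : ℤ} (hr : r + (q - (j : ℕ)) = m') :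
    (diff h θ).ev I (Finset.Ici j) j (Fin.last q) r =
      ((q : ℤ) - (j : ℕ)).negOnePow •
        B.d (by omega) (θ.ev I (Finset.Ici j) j (Fin.last q) (m - ((q : ℤ) - (j : ℕ)))) +
      ∑ i ∈ ((Finset.Ici j).erase j).erase (Fin.last q), (((i : ℕ) : ℤ) - (j : ℕ)).negOnePow •
        θ.ev I ((Finset.Ici j).erase i) j (Fin.last q) r := by
  have hj := j.2
  rw [ev_diff h θ I (ends_Ici j) (by rw [Fin.card_Ici]; omega)]
  refine congrArg₂ (· + ·) ?_ (Finset.sum_congr rfl fun i hi => ?_)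
  · refine congrArg₂ (· • ·) ?_ (d_ev_congr θ I (by omega) _)
    rw [Fin.card_Ici]; congr 1; omega
  · have hij : j ≤ i := by
      simp only [Finset.mem_erase, Finset.mem_Ici] at hi; exact hi.2.2
    have hij' : (j : ℕ) ≤ i := hij
    have : (Finset.Ici j).filter (· < i) = Finset.Ico j i := by
      ext x; simp only [Finset.mem_filter, Finset.mem_Ici, Finset.mem_Ico]
    rw [this, Fin.card_Ico, Nat.cast_sub hij']

theorem diff_mul {a b m m' a' b' : ℤ} (h : a + b = m) (hm : m + 1 = m') (ha : a + 1 = a')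
    (hb : b + 1 = b') (θ : Coch B F G a) (η : Coch B E F b) :
    diff hm (mul h θ η) = mul (by omega) (diff ha θ) η +
      a.negOnePow • mul (by omega) θ (diff hb η) := by
  subst ha hb
  funext q I
  have R1 : ∀ (j : Fin (q + 1)) (hh), B.comp (n := m' - q) hh
      ((diff rfl θ).ev I (Finset.Iic j) 0 j (a + 1 - (j : ℕ)))
      (η.ev I (Finset.Ici j) j (Fin.last q) (b - ((q : ℤ) - (j : ℕ)))) =
      ((j : ℕ) : ℤ).negOnePow • B.comp hh
        (B.d (by omega) (θ.ev I (Finset.Iic j) 0 j (a - (j : ℕ))))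
        (η.ev I (Finset.Ici j) j (Fin.last q) (b - ((q : ℤ) - (j : ℕ)))) +
      ∑ i ∈ ((Finset.Iic j).erase 0).erase j, ((i : ℕ) : ℤ).negOnePow •
        B.comp hh (θ.ev I ((Finset.Iic j).erase i) 0 j (a + 1 - (j : ℕ)))
          (η.ev I (Finset.Ici j) j (Fin.last q) (b - ((q : ℤ) - (j : ℕ)))) := by
    intro j hh
    rw [ev_diff_Iic rfl θ I j (by omega), map_add, map_sum, LinearMap.add_apply,
      LinearMap.sum_apply, comp_negOnePow_left]
    congr 1
    exact Finset.sum_congr rfl fun i _ => comp_negOnePow_left _ _ _ _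
  have R2 : ∀ (j : Fin (q + 1)) (hh), B.comp (n := m' - q) hh
      (θ.ev I (Finset.Iic j) 0 j (a - (j : ℕ)))
      ((diff rfl η).ev I (Finset.Ici j) j (Fin.last q) (b + 1 - ((q : ℤ) - (j : ℕ)))) =
      ((q : ℤ) - (j : ℕ)).negOnePow • B.comp hh
        (θ.ev I (Finset.Iic j) 0 j (a - (j : ℕ)))
        (B.d (by omega) (η.ev I (Finset.Ici j) j (Fin.last q) (b - ((q : ℤ) - (j : ℕ))))) +
      ∑ i ∈ ((Finset.Ici j).erase j).erase (Fin.last q), (((i : ℕ) : ℤ) - (j : ℕ)).negOnePow •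
        B.comp hh (θ.ev I (Finset.Iic j) 0 j (a - (j : ℕ)))
          (η.ev I ((Finset.Ici j).erase i) j (Fin.last q) (b + 1 - ((q : ℤ) - (j : ℕ)))) := by
    intro j hh
    rw [ev_diff_Ici rfl η I j (by omega), map_add, map_sum, comp_negOnePow_right]
    congr 1
    exact Finset.sum_congr rfl fun i _ => comp_negOnePow_right _ _ _ _
  have hq1 : ∀ j : Fin (q + 1), b - ((q : ℤ) - (j : ℕ)) + 1 = b + 1 - ((q : ℤ) - (j : ℕ)) :=
    fun j => by ring
  have hq2 : ∀ j : Fin (q + 1), a - ((j : ℕ) : ℤ) + 1 = a + 1 - ((j : ℕ) : ℤ) :=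
    fun j => by ring
  have L1 : (q : ℤ).negOnePow • B.d (m := m' - q) (by omega) ((mul h θ η) q I) =
      (∑ j : Fin (q + 1), ((a + 1 - (j : ℕ)) * ((q : ℤ) - (j : ℕ))).negOnePow •
        ((j : ℕ) : ℤ).negOnePow • B.comp (by omega)
        (B.d (hq2 j) (θ.ev I (Finset.Iic j) 0 j (a - (j : ℕ))))
        (η.ev I (Finset.Ici j) j (Fin.last q) (b - ((q : ℤ) - (j : ℕ))))) +
      a.negOnePow • ∑ j : Fin (q + 1), ((a - (j : ℕ)) * ((q : ℤ) - (j : ℕ))).negOnePow •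
        ((q : ℤ) - (j : ℕ)).negOnePow • B.comp (by omega)
        (θ.ev I (Finset.Iic j) 0 j (a - (j : ℕ)))
        (B.d (hq1 j) (η.ev I (Finset.Ici j) j (Fin.last q) (b - ((q : ℤ) - (j : ℕ))))) := by
    rw [mul, map_sum, Finset.smul_sum, Finset.smul_sum, ← Finset.sum_add_distrib]
    refine Finset.sum_congr rfl fun j _ => ?_
    rw [d_negOnePow, B.leibniz _ _ (hq2 j) (hq1 j), smul_add, smul_add]
    simp only [smul_smul, ← Int.negOnePow_add]
    refine congrArg₂ (· + ·) (congrArg₂ (· • ·) ?_ rfl) (congrArg₂ (· • ·) ?_ rfl)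
    · congr 1; ring
    · congr 1; ring
  have L2 : ∑ i ∈ (Finset.univ.erase 0).erase (Fin.last q), ((i : ℕ) : ℤ).negOnePow •
        (mul h θ η).ev I (Finset.univ.erase i) 0 (Fin.last q) (m' - q) =
      (∑ j : Fin (q + 1), ((a + 1 - (j : ℕ)) * ((q : ℤ) - (j : ℕ))).negOnePow •
        ∑ i ∈ ((Finset.Iic j).erase 0).erase j, ((i : ℕ) : ℤ).negOnePow •
        B.comp (by omega) (θ.ev I ((Finset.Iic j).erase i) 0 j (a + 1 - (j : ℕ)))
          (η.ev I (Finset.Ici j) j (Fin.last q) (b - ((q : ℤ) - (j : ℕ))))) +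
      a.negOnePow • ∑ j : Fin (q + 1), ((a - (j : ℕ)) * ((q : ℤ) - (j : ℕ))).negOnePow •
        ∑ i ∈ ((Finset.Ici j).erase j).erase (Fin.last q), (((i : ℕ) : ℤ) - (j : ℕ)).negOnePow •
        B.comp (by omega) (θ.ev I (Finset.Iic j) 0 j (a - (j : ℕ)))
          (η.ev I ((Finset.Ici j).erase i) j (Fin.last q) (b + 1 - ((q : ℤ) - (j : ℕ)))) := by
    rw [Finset.sum_congr rfl fun i hi => by
      rw [ev_mul_erase h θ η I (by simp at hi; exact hi.2) (by simp at hi; exact hi.1)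
        (by omega : m' - q + q = m + 1)]]
    simp only [smul_add, Finset.sum_add_distrib, Finset.smul_sum, smul_smul, ← Int.negOnePow_add]
    refine congrArg₂ (· + ·) ?_ ?_
    · rw [Finset.sum_comm' (t' := Finset.univ)
        (s' := fun j => ((Finset.Iic j).erase 0).erase j) (by
          intro i j
          simp only [Finset.mem_erase, Finset.mem_univ, Finset.mem_Ioi, Finset.mem_Iic]
          constructor
          · rintro ⟨⟨-, h0, -⟩, hij⟩; exact ⟨⟨hij.ne, h0, hij.le⟩, trivial⟩
          · rintro ⟨⟨hne, h0, hij⟩, -⟩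
            have hlt := lt_of_le_of_ne hij hne
            exact ⟨⟨(hlt.trans_le (Fin.le_last j)).ne, h0, trivial⟩, hlt⟩)]
      refine Finset.sum_congr rfl fun j _ => Finset.sum_congr rfl fun i _ => ?_
      exact congrArg₂ (· • ·) (congrArg _ (add_comm _ _)) rfl
    · rw [Finset.sum_comm' (t' := Finset.univ)
        (s' := fun j => ((Finset.Ici j).erase j).erase (Fin.last q)) (by
          intro i j
          simp only [Finset.mem_erase, Finset.mem_univ, Finset.mem_Iio, Finset.mem_Ici]
          constructor
          · rintro ⟨⟨hl, -, -⟩, hij⟩; exact ⟨⟨hl, hij.ne', hij.le⟩, trivial⟩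
          · rintro ⟨⟨hl, hne, hij⟩, -⟩
            have hlt := lt_of_le_of_ne hij hne.symm
            exact ⟨⟨hl, (lt_of_le_of_lt (Fin.zero_le j) hlt).ne', trivial⟩, hlt⟩)]
      refine Finset.sum_congr rfl fun j _ => Finset.sum_congr rfl fun i _ => ?_
      refine congrArg₂ (· • ·) ?_ rfl
      rw [Int.negOnePow_eq_iff]
      exact ⟨(j : ℕ) - a, by ring⟩
  change _ = mul _ (diff rfl θ) η q I + a.negOnePow • mul _ θ (diff rfl η) q I
  refine (congrArg₂ (· + ·) L1 L2).trans ?_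
  simp only [mul, R1, R2, smul_add, Finset.sum_add_distrib]
  abel

theorem diff_diff {m m' m'' : ℤ} (h : m + 1 = m') (h' : m' + 1 = m'') (θ : Coch B E F m) :
    diff h' (diff h θ) = 0 := by
  funext q I
  have hq : m' - (q : ℤ) + 1 = m'' - q := by omega
  have hev : ∀ i ∈ (Finset.univ.erase 0).erase (Fin.last q),
      (diff h θ).ev I (Finset.univ.erase i) 0 (Fin.last q) (m'' - q) =
      ((q : ℤ) - 1).negOnePow •
        B.d hq (θ.ev I (Finset.univ.erase i) 0 (Fin.last q) (m' - q)) +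
      ∑ j ∈ ((Finset.univ.erase i).erase 0).erase (Fin.last q),
        (((Finset.univ.erase i).filter (· < j)).card : ℤ).negOnePow •
        θ.ev I ((Finset.univ.erase i).erase j) 0 (Fin.last q) (m'' - q) := by
    intro i hi
    simp only [Finset.mem_erase, Finset.mem_univ, and_true] at hi
    have hc : (Finset.univ.erase i).card = q := by
      rw [Finset.card_erase_of_mem (Finset.mem_univ _), Finset.card_univ, Fintype.card_fin]
      rfl
    rw [ev_diff h θ I (ends_erase hi.2 hi.1) (by rw [hc]; omega), hc]
    exact congrArg₂ (· + ·) (congrArg _ (d_ev_congr θ I (by omega) _)) rfl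
  change (q : ℤ).negOnePow • B.d hq ((diff h θ) q I) + ∑ j ∈ _, _ = 0
  rw [Finset.sum_congr rfl fun i hi => by rw [hev i hi]]
  simp only [smul_add, Finset.sum_add_distrib]
  have h1 : (q : ℤ).negOnePow • B.d hq ((diff h θ) q I) =
      ∑ i ∈ (Finset.univ.erase 0).erase (Fin.last q), (q : ℤ).negOnePow •
        ((i : ℕ) : ℤ).negOnePow •
          B.d hq (θ.ev I (Finset.univ.erase i) 0 (Fin.last q) (m' - q)) := by
    rw [diff, map_add, d_negOnePow, B.d_d, smul_zero, zero_add, map_sum, Finset.smul_sum]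
    exact Finset.sum_congr rfl fun i _ => by rw [d_negOnePow]
  have h2 : ∑ i ∈ (Finset.univ.erase 0).erase (Fin.last q), (q : ℤ).negOnePow •
        ((i : ℕ) : ℤ).negOnePow •
          B.d hq (θ.ev I (Finset.univ.erase i) 0 (Fin.last q) (m' - q)) +
      ∑ i ∈ (Finset.univ.erase 0).erase (Fin.last q), ((i : ℕ) : ℤ).negOnePow •
        ((q : ℤ) - 1).negOnePow •
          B.d hq (θ.ev I (Finset.univ.erase i) 0 (Fin.last q) (m' - q)) = 0 := by
    rw [← Finset.sum_add_distrib]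
    refine Finset.sum_eq_zero fun i _ => ?_
    simp only [smul_smul, ← Int.negOnePow_add]
    rw [show ((i : ℕ) : ℤ) + ((q : ℤ) - 1) = q + (i : ℕ) - 1 by ring, Int.negOnePow_sub,
      Int.negOnePow_one]
    simp [Units.smul_def]
  have h3 : ∑ i ∈ (Finset.univ.erase 0).erase (Fin.last q), ((i : ℕ) : ℤ).negOnePow •
      ∑ j ∈ ((Finset.univ.erase i).erase 0).erase (Fin.last q),
        (((Finset.univ.erase i).filter (· < j)).card : ℤ).negOnePow •
        θ.ev I ((Finset.univ.erase i).erase j) 0 (Fin.last q) (m'' - q) = 0 := by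
    simp only [Finset.smul_sum, smul_smul, ← Int.negOnePow_add]
    rw [Finset.sum_sigma']
    have hcard : ∀ i j : Fin (q + 1), i ≠ j →
        (((Finset.univ.erase i).filter (· < j)).card : ℤ) =
          if i < j then ((j : ℕ) : ℤ) - 1 else (j : ℕ) := by
      intro i j hij
      have : (Finset.univ.erase i).filter (· < j) = (Finset.Iio j).erase i := by
        ext x; simp
      rw [this]
      split_ifs with hlt
      · have hlt' : (i : ℕ) < j := hlt
        rw [Finset.card_erase_of_mem (by simpa using hlt), Fin.card_Iio]; omega
      · rw [Finset.erase_eq_of_notMem (by simpa using hlt), Fin.card_Iio]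
    refine Finset.sum_involution (fun x _ => ⟨x.2, x.1⟩) ?_ ?_ ?_ ?_
    · rintro ⟨i, j⟩ hx
      simp only [Finset.mem_sigma, Finset.mem_erase, Finset.mem_univ, and_true] at hx
      have hij : i ≠ j := hx.2.2.2.symm
      rw [hcard i j hij, hcard j i hij.symm, Finset.erase_right_comm (a := j)]
      rcases lt_or_gt_of_ne hij with hlt | hlt
      · rw [if_pos hlt, if_neg hlt.asymm,
          show ((i : ℕ) : ℤ) + ((j : ℕ) - 1) = (j : ℕ) + (i : ℕ) - 1 by ring, Int.negOnePow_sub,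
          Int.negOnePow_one]
        simp [Units.smul_def]
      · rw [if_pos hlt, if_neg hlt.asymm,
          show ((j : ℕ) : ℤ) + ((i : ℕ) - 1) = (i : ℕ) + (j : ℕ) - 1 by ring, Int.negOnePow_sub,
          Int.negOnePow_one]
        simp [Units.smul_def]
    · rintro ⟨i, j⟩ hx _ heq
      simp only [Finset.mem_sigma, Finset.mem_erase, Finset.mem_univ, and_true] at hx
      simp only [Sigma.mk.injEq] at heq
      exact hx.2.2.2 heq.1
    · rintro ⟨i, j⟩ hx
      simp only [Finset.mem_sigma, Finset.mem_erase, Finset.mem_univ, and_true] at hx ⊢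
      exact ⟨⟨hx.2.1, hx.2.2.1⟩, hx.1.1, hx.1.2, hx.2.2.2.symm⟩
    · rintro ⟨i, j⟩ _; rfl
  rw [h1, h3, add_zero, h2]

theorem one_apply_of_pos (E : Fin (N + 1) → B.Obj) {q : ℕ} (hq : q ≠ 0)
    (I : Fin (q + 1) →o Fin (N + 1)) : one E q I = 0 := by
  cases q with
  | zero => exact absurd rfl hq
  | succ q => rfl

theorem one_ev_of_card (E : Fin (N + 1) → B.Obj) {q : ℕ} (I : Fin (q + 1) →o Fin (N + 1))
    {A : Finset (Fin (q + 1))} (hA : A.card ≠ 1) (s t : Fin (q + 1)) (r : ℤ) :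
    (one E).ev I A s t r = 0 := by
  by_cases h : Ends A s t ∧ r + A.card = 0 + 1
  · rw [ev, dif_pos h, one_apply_of_pos E (by have := h.1.card; omega), map_zero]
  · exact ev_zero_of _ _ h

theorem one_ev_singleton (E : Fin (N + 1) → B.Obj) {q : ℕ} (I : Fin (q + 1) →o Fin (N + 1))
    (s : Fin (q + 1)) : (one E).ev I {s} s s 0 = B.id (E (I s)) := by
  have := (one E).ev_of (l := 0) I
    (OrderEmbedding.ofStrictMono (fun _ : Fin 1 => s) (by
      intro x y hxy
      exact absurd hxy (by
        rw [Fin.ext (by omega : (x : ℕ) = y)]; exact lt_irrefl _))) 0 (by simp)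
    (A := {s}) (s := s) (t := s) (by ext x; simp only [Finset.mem_singleton, Finset.mem_map, Finset.mem_univ, true_and]; exact ⟨fun h => ⟨0, h.symm⟩, fun ⟨_, h⟩ => h.symm⟩) rfl rfl
  exact this

theorem one_mul {m : ℤ} (h : 0 + m = m) (θ : Coch B E F m) : mul h (one F) θ = θ := by
  funext q I
  rw [mul, Finset.sum_eq_single 0]
  · rw [comp_ev_congr (one F) θ I (A₁' := {0}) (A₂' := Finset.univ) (r₁' := 0) (r₂' := m - q)
      (by ext x; simp) (by ext x; simp) (by simp) (by simp), one_ev_singleton, ev_univ,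
      B.id_comp]
    simp
  · intro j _ hj
    have h0 : (j : ℕ) ≠ 0 := fun h => hj (Fin.ext h)
    rw [one_ev_of_card F I (by rw [Fin.card_Iic]; omega),
      LinearMap.map_zero (B.comp _), LinearMap.zero_apply, smul_zero]
  · simp

theorem mul_one {m : ℤ} (h : m + 0 = m) (θ : Coch B E F m) : mul h θ (one E) = θ := by
  funext q I
  rw [mul, Finset.sum_eq_single (Fin.last q)]
  · rw [comp_ev_congr θ (one E) I (A₁' := Finset.univ) (A₂' := {Fin.last q}) (r₁' := m - q)
      (r₂' := 0) (by ext x; simp [Fin.le_last]) (by ext x; simp [Fin.last_le_iff]) (by simp)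
      (by simp), one_ev_singleton, ev_univ, B.comp_id]
    simp
  · intro j _ hj
    have h0 : (j : ℕ) ≠ q := fun h => hj (Fin.ext h)
    have h1 := j.2
    rw [one_ev_of_card E I (by rw [Fin.card_Ici]; omega),
      LinearMap.map_zero (B.comp _ _), smul_zero]
  · simp

theorem ev_add {m : ℤ} (θ θ' : Coch B E F m) {q : ℕ} (I : Fin (q + 1) →o Fin (N + 1))
    (A : Finset (Fin (q + 1))) (s t : Fin (q + 1)) (r : ℤ) :
    (θ + θ').ev I A s t r = θ.ev I A s t r + θ'.ev I A s t r := by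
  unfold ev
  split_ifs with h
  · exact map_add _ _ _
  · simp

theorem ev_smul {m : ℤ} (c : k) (θ : Coch B E F m) {q : ℕ} (I : Fin (q + 1) →o Fin (N + 1))
    (A : Finset (Fin (q + 1))) (s t : Fin (q + 1)) (r : ℤ) :
    (c • θ).ev I A s t r = c • θ.ev I A s t r := by
  unfold ev
  split_ifs with h
  · exact map_smul _ _ _
  · simp

end Laws

end Coch

/-- The dg-category of cochains: its objects are collections `E₀, …, E_N` of objects of `B`, its
morphisms are cochains with the differential `D` and the shuffled multiplication. -/
noncomputable def cochains (B : DGCat.{w, v, u} k) (N : ℕ) : DGCat.{w, v, u} k where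
  Obj := Fin (N + 1) → B.Obj
  Hom E F m := Coch B E F m
  d h :=
    { toFun := Coch.diff h
      map_add' := fun θ θ' => by
        funext q I
        change _ = Coch.diff h θ q I + Coch.diff h θ' q I
        simp only [Coch.diff, Pi.add_apply, map_add, smul_add, Coch.ev_add,
          Finset.sum_add_distrib]
        abel
      map_smul' := fun c θ => by
        funext q I
        change _ = c • Coch.diff h θ q I
        simp only [Coch.diff, Pi.smul_apply, map_smul, Coch.ev_smul, smul_add, Finset.smul_sum,
          smul_comm c] }
  comp h := LinearMap.mk₂ k (fun θ η => Coch.mul h θ η)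
    (fun θ θ' η => by
      funext q I
      change _ = Coch.mul h θ η q I + Coch.mul h θ' η q I
      simp only [Coch.mul, Coch.ev_add, map_add, LinearMap.add_apply, smul_add,
        Finset.sum_add_distrib])
    (fun c θ η => by
      funext q I
      change _ = c • Coch.mul h θ η q I
      simp only [Coch.mul, Coch.ev_smul, map_smul, LinearMap.smul_apply, Finset.smul_sum,
        smul_comm c])
    (fun θ η η' => by
      funext q I
      change _ = Coch.mul h θ η q I + Coch.mul h θ η' q I
      simp only [Coch.mul, Coch.ev_add, map_add, smul_add, Finset.sum_add_distrib])
    (fun c θ η => by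
      funext q I
      change _ = c • Coch.mul h θ η q I
      simp only [Coch.mul, Coch.ev_smul, map_smul, Finset.smul_sum, smul_comm c])
  id E := Coch.one E
  d_d h h' θ := Coch.diff_diff h h' θ
  leibniz h hn hp hq θ η := Coch.diff_mul h hn hp hq θ η
  assoc h₁ h₂ h₃ h₄ θ η ζ := Coch.mul_assoc h₁ h₂ h₃ h₄ θ η ζ
  id_comp h θ := Coch.one_mul h θ
  comp_id h θ := Coch.mul_one h θ

end Cochains

/-- Twisting a dg-category by Maurer-Cartan elements: for a family `φ o` of degree `1`
endomorphisms of objects `ob o` with `dφ + φφ = 0`, the dg-category with objects `o`, morphisms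
those of `C`, and differential `f ↦ df + φ f - (-1)^{deg f} f φ`. -/
def twist (C : DGCat.{w, v, u} k) {O : Type u'} (ob : O → C.Obj)
    (φ : ∀ o, C.Hom (ob o) (ob o) 1)
    (mc : ∀ o, C.d (m := 2) (by omega) (φ o) + C.comp (by omega) (φ o) (φ o) = 0) :
    DGCat.{w, v, u'} k where
  Obj := O
  Hom x y n := C.Hom (ob x) (ob y) n
  d {x y n m} h :=
    { toFun := fun f => C.d h f + C.comp (by omega) (φ y) f -
        n.negOnePow • C.comp (by omega) f (φ x)
      map_add' := fun f g => by simp only [map_add, LinearMap.add_apply, smul_add]; abel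
      map_smul' := fun c f => by
        simp only [map_smul, LinearMap.smul_apply, smul_sub, smul_add, RingHom.id_apply,
          smul_comm c] }
  comp h := C.comp h
  id x := C.id (ob x)
  d_d {x y n m l} h h' f := by
    subst h h'
    have e1 := mc x
    have e2 := mc y
    simp only [LinearMap.coe_mk, AddHom.coe_mk, map_add, map_sub, C.d_d,
      Coch.d_negOnePow, Coch.comp_negOnePow_left, Coch.comp_negOnePow_right]
    rw [C.leibniz (p' := 2) (q' := n + 1) (by omega : 1 + n = n + 1) (by omega) (by omega) rfl (φ y) f,
      C.leibniz (p' := n + 1) (q' := 2) (by omega : n + 1 = n + 1) (by omega) (by omega) (by omega) f (φ x),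
      C.assoc (b := n + 1) (by omega : 1 + n = n + 1) (by omega : n + 1 + 1 = n + 1 + 1) (by omega) (by omega)
        (φ y) f (φ x),
      ← C.assoc (a := 2) (by omega) (by omega : 2 + n = n + 1 + 1) (by omega : 1 + n = n + 1) (by omega)
        (φ y) (φ y) f,
      C.assoc (b := 2) (by omega : n + 1 = n + 1) (by omega : n + 1 + 1 = n + 1 + 1) (by omega)
        (by omega) f (φ x) (φ x)]
    have e1' := congrArg (C.comp (by omega : n + 2 = n + 1 + 1) f) e1
    have e2' := congrArg (fun a => C.comp (by omega : 2 + n = n + 1 + 1) a f) e2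
    simp only [map_add, LinearMap.add_apply, map_zero, LinearMap.zero_apply] at e1' e2'
    rw [eq_neg_of_add_eq_zero_left e1', eq_neg_of_add_eq_zero_left e2']
    have hs : n.negOnePow * n.negOnePow = 1 := by
      rw [← Int.negOnePow_add, Int.negOnePow_even _ ⟨n, rfl⟩]
    simp only [smul_add, smul_neg, smul_smul, Int.negOnePow_succ, Int.negOnePow_one,
      Units.neg_smul, neg_mul, hs, _root_.one_smul]
    abel
  leibniz {x y z p p' q q' n m} h hn hp hq f g := by
    subst h hn hp hq
    have l1 := C.leibniz rfl rfl rfl rfl f g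
    have l2 := C.assoc (a := p + 1) (b := q + 1) (by omega) (by omega : p + 1 + q = p + q + 1)
      (by omega) (by omega) f (φ y) g
    have l3 := C.assoc (a := p + 1) (b := p + q) (by omega) (by omega : p + 1 + q = p + q + 1)
      rfl (by omega) (φ z) f g
    have l4 := C.assoc (b := q + 1) rfl (by omega : p + q + 1 = p + q + 1) rfl (by omega)
      f g (φ x)
    simp only [LinearMap.coe_mk, AddHom.coe_mk, map_add, map_sub, LinearMap.add_apply,
      LinearMap.sub_apply, Coch.comp_negOnePow_left, Coch.comp_negOnePow_right, l1, l2, l3, l4,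
      smul_add, smul_sub, smul_smul, ← Int.negOnePow_add]
    abel
  assoc h₁ h₂ h₃ h₄ f g e := C.assoc h₁ h₂ h₃ h₄ f g e
  id_comp h f := C.id_comp h f
  comp_id h f := C.comp_id h f

end DGCat

/-- Two conventions for the degenerate components of the objects of `Δ_n(B)`: either
`φ_{ii} = id` and `φ_{i₀…i_q} = 0` for `q ≥ 2` and repeated indices, or no such conditions. -/
inductive DegeneracyConvention
  | normalized
  | unnormalized

namespace DGCat

variable {k : Type w} [CommRing k]

/-- The objects of the dg-category `Δ_N(B)`. The components `φ_{i₀…i_q}` are given for `q ≥ 1`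
only; this is expressed by putting the component for `q = 0` equal to `0`. -/
structure SimplexObj (c : DegeneracyConvention) (B : DGCat.{w, v, u} k) (N : ℕ) where
  E : Fin (N + 1) → B.Obj
  φ : Coch B E E 1
  φ_zero : ∀ I : Fin 1 →o Fin (N + 1), φ 0 I = 0
  maurerCartan : Coch.diff (m' := 2) (by omega) φ + Coch.mul (by omega) φ φ = 0
  invertible : ∀ I : Fin 2 →o Fin (N + 1), B.HomotopyInvertible (by simp) (φ 1 I)
  normalized : c = .normalized →
    (∀ (I : Fin 2 →o Fin (N + 1)) (h : I 0 = I (Fin.last 1)),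
      φ 1 I = B.castHom (congrArg E h) rfl (by simp) (B.id (E (I 0)))) ∧
    (∀ (q : ℕ) (I : Fin (q + 1) →o Fin (N + 1)), 2 ≤ q → ¬ Function.Injective I → φ q I = 0)

/-- The dg-category `Δ_N(B)`, with differential `dθ = Dθ + ψ·θ - (-1)^m θ·φ` on the morphisms of
degree `m` from `(E, φ)` to `(F, ψ)`. -/
noncomputable def simplex (c : DegeneracyConvention) (B : DGCat.{w, v, u} k) (N : ℕ) :
    DGCat.{w, v, max u v} k :=
  (cochains B N).twist (O := SimplexObj c B N) (fun x => x.E) (fun x => x.φ)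
    (fun x => x.maurerCartan)

section Functoriality

variable {c : DegeneracyConvention} {A B : DGCat.{w, v, u} k} {M N : ℕ}

/-- The restriction of cochains along an order preserving map `[M] → [N]`. -/
def Coch.restrict (σ : Fin (M + 1) →o Fin (N + 1)) {E F : Fin (N + 1) → B.Obj} {m : ℤ}
    (θ : Coch B E F m) : Coch B (fun i => E (σ i)) (fun i => F (σ i)) m :=
  fun q I => θ q (σ.comp I)

/-- The simplicial structure map `σ^*` on objects. -/
noncomputable def SimplexObj.restrict (σ : Fin (M + 1) →o Fin (N + 1))
    (x : (simplex c B N).Obj) : (simplex c B M).Obj :=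
  SimplexObj.mk (c := c) (B := B) (N := M)
    (E := fun i => x.E (σ i))
    (φ := x.φ.restrict σ)
    (φ_zero := fun I => x.φ_zero (σ.comp I))
    (maurerCartan := by
      funext q I
      exact congrFun (congrFun x.maurerCartan q) (σ.comp I))
    (invertible := fun I => x.invertible (σ.comp I))
    (normalized := fun hc =>
      ⟨fun I h => (x.normalized hc).1 (σ.comp I) (congrArg σ h),
        fun q I hq hI => (x.normalized hc).2 q (σ.comp I) hq
          (fun h => hI (Function.Injective.of_comp (f := σ) h))⟩)

/-- The simplicial structure map `σ^* : Δ_N(B) → Δ_M(B)` of an order preserving map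
`σ : [M] → [N]`. -/
noncomputable def simplexRestrict (c : DegeneracyConvention) (B : DGCat.{w, v, u} k)
    (σ : Fin (M + 1) →o Fin (N + 1)) : simplex c B N ⟶ simplex c B M where
  obj x := SimplexObj.restrict σ x
  map :=
    { toFun := fun θ => Coch.restrict σ θ
      map_add' := fun _ _ => rfl
      map_smul' := fun _ _ => rfl }
  map_d h θ := rfl
  map_comp h θ η := rfl
  map_id x := by
    funext q I
    cases q <;> rfl

/-- The image of a cochain under a dg-functor. -/
def Coch.map (F : A ⟶ B) {E E' : Fin (N + 1) → A.Obj} {m : ℤ}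
    (θ : Coch A E E' m) : Coch B (fun i => F.obj (E i)) (fun i => F.obj (E' i)) m :=
  fun q I => F.map (θ q I)

theorem map_castHom (F : A ⟶ B) {x x' y y' : A.Obj} {n n' : ℤ}
    (hx : x = x') (hy : y = y') (hn : n = n') (f : A.Hom x y n) :
    F.map (A.castHom hx hy hn f) =
      B.castHom (congrArg F.obj hx) (congrArg F.obj hy) hn (F.map f) := by
  subst hx hy hn; rfl

theorem map_negOnePow (F : A ⟶ B) {x y : A.Obj} {n : ℤ} (a : ℤ) (f : A.Hom x y n) :
    F.map (a.negOnePow • f) = a.negOnePow • F.map f := by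
  simp [Units.smul_def]

theorem HomotopyInvertible.map (F : A ⟶ B) {x y : A.Obj} {n : ℤ} {hn : n = 0}
    {f : A.Hom x y n} (hf : A.HomotopyInvertible hn f) : B.HomotopyInvertible hn (F.map f) := by
  obtain ⟨h, g, a, b, hg, ha, hb⟩ := hf
  refine ⟨?_, F.map g, F.map a, F.map b, ?_, ?_, ?_⟩
  · rw [← F.map_d, h, map_zero]
  · rw [← F.map_d, hg, map_zero]
  · rw [← F.map_d, ← ha, map_sub, F.map_comp, F.map_id]
  · rw [← F.map_d, ← hb, map_sub, F.map_comp, F.map_id]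

theorem Coch.ev_map (F : A ⟶ B) {E E' : Fin (N + 1) → A.Obj} {m : ℤ} (θ : Coch A E E' m) {q : ℕ}
    (I : Fin (q + 1) →o Fin (N + 1)) (S : Finset (Fin (q + 1))) (s t : Fin (q + 1)) (r : ℤ) :
    (Coch.map F θ).ev I S s t r = F.map (θ.ev I S s t r) := by
  unfold Coch.ev
  split_ifs with h
  · exact (map_castHom F _ _ _ _).symm
  · exact (map_zero _).symm

theorem Coch.map_diff (F : A ⟶ B) {E E' : Fin (N + 1) → A.Obj} {m m' : ℤ} (h : m + 1 = m')
    (θ : Coch A E E' m) : Coch.map F (Coch.diff h θ) = Coch.diff h (Coch.map F θ) := by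
  funext q I
  simp only [Coch.diff, Coch.ev_map, Coch.map, map_add, map_sum, map_negOnePow, F.map_d]

theorem Coch.map_mul (F : A ⟶ B) {E E' E'' : Fin (N + 1) → A.Obj} {a b m : ℤ} (h : a + b = m)
    (θ : Coch A E' E'' a) (η : Coch A E E' b) :
    Coch.map F (Coch.mul h θ η) = Coch.mul h (Coch.map F θ) (Coch.map F η) := by
  funext q I
  simp only [Coch.mul, Coch.ev_map, map_negOnePow, Coch.map, map_sum, F.map_comp]

/-- The dg-functor `Δ_N(A) → Δ_N(B)` induced by a dg-functor `A → B`, on objects. -/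
noncomputable def SimplexObj.map (F : A ⟶ B) (x : (simplex c A N).Obj) : (simplex c B N).Obj :=
  SimplexObj.mk (c := c) (B := B) (N := N)
    (E := fun i => F.obj (x.E i))
    (φ := Coch.map F x.φ)
    (φ_zero := fun I => (congrArg F.map (x.φ_zero I)).trans (map_zero _))
    (maurerCartan := by
      rw [← Coch.map_diff, ← Coch.map_mul]
      funext q I
      exact ((map_add F.map _ _).symm.trans
        (congrArg F.map (congrFun (congrFun x.maurerCartan q) I))).trans (map_zero _))
    (invertible := fun I => (x.invertible I).map F)
    (normalized := fun hc =>
      ⟨fun I h => (congrArg F.map ((x.normalized hc).1 I h)).trans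
          ((map_castHom F _ _ _ _).trans (congrArg _ (F.map_id _))),
        fun q I hq hI => (congrArg F.map ((x.normalized hc).2 q I hq hI)).trans (map_zero _)⟩)

/-- The dg-functor `Δ_N(A) → Δ_N(B)` induced by a dg-functor `A → B`. -/
noncomputable def simplexMap (c : DegeneracyConvention) (F : A ⟶ B) (N : ℕ) :
    simplex c A N ⟶ simplex c B N where
  obj x := SimplexObj.map F x
  map :=
    { toFun := fun θ => Coch.map F θ
      map_add' := fun θ θ' => by funext q I; exact map_add F.map _ _
      map_smul' := fun a θ => by funext q I; exact map_smul F.map _ _ }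
  map_d {x y n m} h θ := by
    have e1 := Coch.map_diff F h θ
    have e2 := Coch.map_mul F (by omega : 1 + n = m) y.φ θ
    have e3 := Coch.map_mul F (by omega : n + 1 = m) θ x.φ
    funext q I
    have e1' := congrFun (congrFun e1 q) I
    have e2' := congrFun (congrFun e2 q) I
    have e3' := congrFun (congrFun e3 q) I
    refine Eq.trans (map_sub F.map _ _) ?_
    refine congrArg₂ (· - ·) ((map_add F.map _ _).trans (congrArg₂ (· + ·) e1' e2')) ?_
    exact (map_negOnePow F n _).trans (congrArg _ e3')
  map_comp h θ η := Coch.map_mul F h θ η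
  map_id x := by
    funext q I
    cases q with
    | zero => exact (map_castHom F _ _ _ _).trans (congrArg _ (F.map_id _))
    | succ q => exact map_zero F.map

end Functoriality

open scoped Simplicial in
/-- The totalization of a cosimplicial dg-category `B^•`: the equalizer of
`∏_n Δ_n(B^n) ⇉ ∏_{σ : [n] → [m]} Δ_n(B^m)`, where one map is given by
`Δ_n(σ_*) : Δ_n(B^n) → Δ_n(B^m)` and the other by `σ^* : Δ_m(B^m) → Δ_n(B^m)`. -/
noncomputable def Tot (c : DegeneracyConvention) (B : CosimplicialObject (DGCat.{w, v, u} k)) :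
    DGCat.{w, v, max u v} k :=
  equalizer (A := pi fun n : ℕ => simplex c (B.obj ⦋n⦌) n)
    (B := pi fun σ : Σ n m : ℕ, (⦋n⦌ ⟶ ⦋m⦌ : Type) => simplex c (B.obj ⦋σ.2.1⦌) σ.1)
    (piLift fun σ => piProj _ σ.1 ≫ simplexMap c (B.map σ.2.2) σ.1)
    (piLift fun σ => piProj _ σ.2.1 ≫ simplexRestrict c (B.obj ⦋σ.2.1⦌) σ.2.2.toOrderHom)

end DGCat

/-- A dg pseudo-functor on a category `C`, with values in dg-categories. The isomorphism
`α f g h w : f^* g^* ≅ h^*` is indexed by all commutative triangles `w : f ≫ g = h`. -/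
structure DGPseudoFunctor (k : Type w) [CommRing k] (C : Type u₁) [Category.{v₁} C] where
  obj : C → DGCat.{w, v, u} k
  map : ∀ {X Y : C}, (X ⟶ Y) → (obj Y ⟶ obj X)
  ε : ∀ (X : C) (x : (obj X).Obj), (obj X).Hom ((map (𝟙 X)).obj x) x 0
  ε_iso : ∀ (X : C) (x : (obj X).Obj), (obj X).IsStrictIso (ε X x)
  ε_naturality : ∀ (X : C) {x y : (obj X).Obj} {n : ℤ} (a : (obj X).Hom x y n),
    (obj X).comp (by omega : n + 0 = n) a (ε X x) =
      (obj X).comp (by omega) (ε X y) ((map (𝟙 X)).map a)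
  α : ∀ {X Y Z : C} (f : X ⟶ Y) (g : Y ⟶ Z) (h : X ⟶ Z) (_ : f ≫ g = h) (z : (obj Z).Obj),
    (obj X).Hom ((map f).obj ((map g).obj z)) ((map h).obj z) 0
  α_iso : ∀ {X Y Z : C} (f : X ⟶ Y) (g : Y ⟶ Z) (h : X ⟶ Z) (w : f ≫ g = h) (z : (obj Z).Obj),
    (obj X).IsStrictIso (α f g h w z)
  α_naturality : ∀ {X Y Z : C} (f : X ⟶ Y) (g : Y ⟶ Z) (h : X ⟶ Z) (w : f ≫ g = h)
    {x y : (obj Z).Obj} {n : ℤ} (a : (obj Z).Hom x y n),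
    (obj X).comp (by omega : n + 0 = n) ((map h).map a) (α f g h w x) =
      (obj X).comp (by omega) (α f g h w y) ((map f).map ((map g).map a))
  α_id_left : ∀ {X Y : C} (f : X ⟶ Y) (y : (obj Y).Obj),
    α (𝟙 X) f f (Category.id_comp f) y = ε X ((map f).obj y)
  α_id_right : ∀ {X Y : C} (f : X ⟶ Y) (y : (obj Y).Obj),
    α f (𝟙 Y) f (Category.comp_id f) y = (map f).map (ε Y y)
  α_assoc : ∀ {X Y Z W : C} (f : X ⟶ Y) (g : Y ⟶ Z) (h : Z ⟶ W) (t : (obj W).Obj),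
    (obj X).comp (by omega : (0 : ℤ) + 0 = 0)
        (α (f ≫ g) h (f ≫ g ≫ h) (Category.assoc f g h) t)
        (α f g (f ≫ g) rfl ((map h).obj t)) =
      (obj X).comp (by omega) (α f (g ≫ h) (f ≫ g ≫ h) rfl t)
        ((map f).map (α g h (g ≫ h) rfl t))

namespace DGPseudoFunctor

variable {k : Type w} [CommRing k] {C : Type u₁} [Category.{v₁} C]
  (F : DGPseudoFunctor.{w, v, u, v₁, u₁} k C)

/-- The objects of `F̃(X)`: the functors `C/X → F` fibered over `C`. Such a functor sends
`h : Y ⟶ X` to an object of `F(Y)` and a morphism `g` from `h' : Z ⟶ X` to `h : Y ⟶ X` over `X`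
to a strict isomorphism from `ξ(h')` to `g^* ξ(h)`. -/
structure RectObj (X : C) where
  obj : ∀ {Y : C}, (Y ⟶ X) → (F.obj Y).Obj
  tr : ∀ {Z Y : C} (g : Z ⟶ Y) (h : Y ⟶ X) (h' : Z ⟶ X) (_ : g ≫ h = h'),
    (F.obj Z).Hom (obj h') ((F.map g).obj (obj h)) 0
  tr_iso : ∀ {Z Y : C} (g : Z ⟶ Y) (h : Y ⟶ X) (h' : Z ⟶ X) (w : g ≫ h = h'),
    (F.obj Z).IsStrictIso (tr g h h' w)
  tr_id : ∀ {Y : C} (h : Y ⟶ X),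
    (F.obj Y).comp (by omega) (F.ε Y (obj h)) (tr (𝟙 Y) h h (Category.id_comp h)) =
      (F.obj Y).id (obj h)
  tr_comp : ∀ {W Z Y : C} (g' : W ⟶ Z) (g : Z ⟶ Y) (h : Y ⟶ X) (h' : Z ⟶ X) (h'' : W ⟶ X)
    (w : g ≫ h = h') (w' : g' ≫ h' = h''),
    tr (g' ≫ g) h h'' (by rw [Category.assoc, w, w']) =
      (F.obj W).comp (by omega : (0 : ℤ) + 0 = 0) (F.α g' g (g' ≫ g) rfl (obj h))
        ((F.obj W).comp (by omega) ((F.map g').map (tr g h h' w)) (tr g' h' h'' w'))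

/-- The degree `n` morphisms of `F̃(X)`: natural transformations of degree `n`. -/
def RectHom {X : C} (ξ η : F.RectObj X) (n : ℤ) :
    Submodule k (∀ (Y : C) (h : Y ⟶ X), (F.obj Y).Hom (ξ.obj h) (η.obj h) n) where
  carrier := {T | ∀ {Z Y : C} (g : Z ⟶ Y) (h : Y ⟶ X) (h' : Z ⟶ X) (w : g ≫ h = h'),
    (F.obj Z).comp (by omega : 0 + n = n) (η.tr g h h' w) (T Z h') =
      (F.obj Z).comp (by omega) ((F.map g).map (T Y h)) (ξ.tr g h h' w)}
  add_mem' {S T} hS hT Z Y g h h' w := by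
    simp only [Pi.add_apply, map_add, LinearMap.add_apply, hS g h h' w, hT g h h' w]
  zero_mem' {Z Y} g h h' w := by simp
  smul_mem' a T hT Z Y g h h' w := by
    simp only [Pi.smul_apply, map_smul, LinearMap.smul_apply, hT g h h' w]

/-- The dg-category `F̃(X) = Fun_C(C/X, F)`. -/
def rect (X : C) : DGCat.{w, max u₁ v₁ v, max u₁ v₁ u v} k where
  Obj := F.RectObj X
  Hom ξ η n := F.RectHom ξ η n
  d {ξ η n m} e :=
    { toFun := fun T => ⟨fun Y h => (F.obj Y).d e (T.1 Y h), by
        intro Z Y g h h' w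
        have e1 := congrArg ((F.obj Z).d e) (T.2 g h h' w)
        rw [(F.obj Z).leibniz (p' := 1) (q' := m) _ _ (by omega) e,
          (F.obj Z).leibniz (p' := m) (q' := 1) _ _ e (by omega),
          (η.tr_iso g h h' w).1, (ξ.tr_iso g h h' w).1] at e1
        rw [(F.map g).map_d]
        simpa using e1⟩
      map_add' := fun S T => by ext; simp
      map_smul' := fun a T => by ext; simp }
  comp {ξ η ζ p q n} e := LinearMap.mk₂ k
    (fun S T => ⟨fun Y h => (F.obj Y).comp e (S.1 Y h) (T.1 Y h), by
      intro Z Y g h h' w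
      rw [(F.map g).map_comp,
        ← (F.obj Z).assoc (by omega : 0 + p = p) e _ _ (ζ.tr g h h' w), S.2 g h h' w,
        (F.obj Z).assoc (b := q) _ _ (by omega) e, T.2 g h h' w,
        ← (F.obj Z).assoc e (by omega) _ _]⟩)
    (fun _ _ _ => by ext; simp) (fun _ _ _ => by ext; simp)
    (fun _ _ _ => by ext; simp) (fun _ _ _ => by ext; simp)
  id ξ := ⟨fun Y h => (F.obj Y).id (ξ.obj h), by
    intro Z Y g h h' w
    rw [(F.map g).map_id, (F.obj Z).comp_id, (F.obj Z).id_comp]⟩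
  d_d e e' T := Subtype.ext (funext fun Y => funext fun h => (F.obj Y).d_d e e' (T.1 Y h))
  leibniz e e₁ e₂ e₃ S T := Subtype.ext (funext fun Y => funext fun h =>
    (F.obj Y).leibniz e e₁ e₂ e₃ (S.1 Y h) (T.1 Y h))
  assoc e₁ e₂ e₃ e₄ R S T := Subtype.ext (funext fun Y => funext fun h =>
    (F.obj Y).assoc e₁ e₂ e₃ e₄ (R.1 Y h) (S.1 Y h) (T.1 Y h))
  id_comp e T := Subtype.ext (funext fun Y => funext fun h => (F.obj Y).id_comp e (T.1 Y h))
  comp_id e T := Subtype.ext (funext fun Y => funext fun h => (F.obj Y).comp_id e (T.1 Y h))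

/-- The pull-back of an object of `F̃(X')` along a functor `C/X → C/X'` over `C`, that is, along
a natural map `p` from the arrows to `X` to the arrows to `X'`. -/
def pullObj {X X' : C} (p : ∀ Y : C, (Y ⟶ X) → (Y ⟶ X'))
    (hp : ∀ {Z Y : C} (g : Z ⟶ Y) (h : Y ⟶ X), g ≫ p Y h = p Z (g ≫ h))
    (ξ : (F.rect X').Obj) : (F.rect X).Obj :=
  RectObj.mk (F := F) (X := X)
    (obj := fun h => ξ.obj (p _ h))
    (tr := fun g h h' w => ξ.tr g (p _ h) (p _ h') (by rw [hp, w]))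
    (tr_iso := fun g h h' w => ξ.tr_iso g (p _ h) (p _ h') (by rw [hp, w]))
    (tr_id := fun h => ξ.tr_id (p _ h))
    (tr_comp := fun g' g h h' h'' w w' =>
      ξ.tr_comp g' g (p _ h) (p _ h') (p _ h'') (by rw [hp, w]) (by rw [hp, w']))

/-- The dg-functor `F̃(X') → F̃(X)` which is given by composition with a functor `C/X → C/X'`
over `C`. -/
def pullAlong {X X' : C} (p : ∀ Y : C, (Y ⟶ X) → (Y ⟶ X'))
    (hp : ∀ {Z Y : C} (g : Z ⟶ Y) (h : Y ⟶ X), g ≫ p Y h = p Z (g ≫ h)) :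
    F.rect X' ⟶ F.rect X where
  obj ξ := F.pullObj p hp ξ
  map :=
    { toFun := fun T => ⟨fun Y h => T.1 Y (p Y h), fun g h h' w =>
        T.2 g (p _ h) (p _ h') (by rw [hp, w])⟩
      map_add' := fun _ _ => rfl
      map_smul' := fun _ _ => rfl }
  map_d _ _ := rfl
  map_comp _ _ _ := rfl
  map_id _ := rfl

theorem pullAlong_congr {X X' : C} {p p' : ∀ Y : C, (Y ⟶ X) → (Y ⟶ X')} (h : p = p')
    (hp : ∀ {Z Y : C} (g : Z ⟶ Y) (h : Y ⟶ X), g ≫ p Y h = p Z (g ≫ h))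
    (hp' : ∀ {Z Y : C} (g : Z ⟶ Y) (h : Y ⟶ X), g ≫ p' Y h = p' Z (g ≫ h)) :
    F.pullAlong p hp = F.pullAlong p' hp' := by
  subst h; rfl

/-- The rectification of `F`, as a strict functor: `f : X ⟶ X'` acts by composition with
`C/X → C/X'`. -/
def rectification : Cᵒᵖ ⥤ DGCat.{w, max u₁ v₁ v, max u₁ v₁ u v} k where
  obj X := F.rect X.unop
  map f := F.pullAlong (fun _ h => h ≫ f.unop) (fun _ _ => (Category.assoc _ _ _).symm)
  map_id X := F.pullAlong_congr (p' := fun _ h => h)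
    (funext fun _ => funext fun h => Category.comp_id h) _ (fun _ _ => rfl)
  map_comp f g := F.pullAlong_congr (p' := fun _ h => (h ≫ g.unop) ≫ f.unop)
    (funext fun _ => funext fun h => (Category.assoc _ _ _).symm) _
    (fun _ _ => by simp only [Category.assoc])

end DGPseudoFunctor

open MonoidalCategory CartesianMonoidalCategory MonObj in
/-- A right action of a group object `G` on an object `X`. -/
structure RightAction {C : Type u₁} [Category.{v₁} C] [CartesianMonoidalCategory C]
    (X G : C) [GrpObj G] where
  act : X ⊗ G ⟶ X
  act_one : ∀ {T : C} (x : T ⟶ X), lift x (1 : T ⟶ G) ≫ act = x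
  act_mul : ∀ {T : C} (x : T ⟶ X) (g h : T ⟶ G),
    lift (lift x g ≫ act) h ≫ act = lift x (g * h) ≫ act

namespace RightAction

open MonoidalCategory CartesianMonoidalCategory MonObj

variable {C : Type u₁} [Category.{v₁} C] [CartesianMonoidalCategory C] {X G : C} [GrpObj G]

/-- The point `x · g`, for `T`-valued points `x` and `g`. -/
def smul (a : RightAction X G) {T : C} (x : T ⟶ X) (g : T ⟶ G) : T ⟶ X := lift x g ≫ a.act

/-- `[X/G]_n = X × G × … × G`. -/
def space (_ : RightAction X G) : ℕ → C
  | 0 => X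
  | n + 1 => space ‹_› n ⊗ G

/-- The coordinate `x` on `[X/G]_n`. -/
def pt (a : RightAction X G) : ∀ n : ℕ, a.space n ⟶ X
  | 0 => 𝟙 X
  | n + 1 => fst (a.space n) G ≫ a.pt n

/-- The coordinates `g_1, …, g_n` on `[X/G]_n`, with indices shifted to `0, …, n - 1`. -/
def gp (a : RightAction X G) : ∀ n : ℕ, Fin n → (a.space n ⟶ G)
  | 0 => Fin.elim0
  | n + 1 => Fin.snoc (α := fun _ => a.space (n + 1) ⟶ G)
      (fun i => fst (a.space n) G ≫ a.gp n i) (snd (a.space n) G)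

/-- The `T`-valued point of `[X/G]_n` with given coordinates `x, g_1, …, g_n`. -/
def tuple (a : RightAction X G) {T : C} (x : T ⟶ X) : ∀ {n : ℕ}, (Fin n → (T ⟶ G)) →
    (T ⟶ a.space n)
  | 0, _ => x
  | _ + 1, g => lift (a.tuple x (fun i => g i.castSucc)) (g (Fin.last _))

variable (a : RightAction X G)

theorem tuple_pt {T : C} (x : T ⟶ X) : ∀ {n : ℕ} (g : Fin n → (T ⟶ G)),
    a.tuple x g ≫ a.pt n = x
  | 0, _ => Category.comp_id _
  | n + 1, g => by
    change lift _ _ ≫ fst _ _ ≫ a.pt n = x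
    rw [lift_fst_assoc, tuple_pt]

theorem gp_last (n : ℕ) : a.gp (n + 1) (Fin.last n) = snd (a.space n) G :=
  Fin.snoc_last (α := fun _ => a.space (n + 1) ⟶ G) _ _

theorem gp_castSucc (n : ℕ) (i : Fin n) :
    a.gp (n + 1) i.castSucc = fst (a.space n) G ≫ a.gp n i :=
  Fin.snoc_castSucc (α := fun _ => a.space (n + 1) ⟶ G) _ _ _

theorem tuple_gp {T : C} (x : T ⟶ X) : ∀ {n : ℕ} (g : Fin n → (T ⟶ G)) (i : Fin n),
    a.tuple x g ≫ a.gp n i = g i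
  | 0, _, i => i.elim0
  | n + 1, g, i => by
    induction i using Fin.lastCases with
    | last =>
      refine (congrArg (a.tuple x g ≫ ·) (a.gp_last n)).trans ?_
      exact lift_snd _ _
    | cast i =>
      refine (congrArg (a.tuple x g ≫ ·) (a.gp_castSucc n i)).trans ?_
      refine (lift_fst_assoc _ _ _).trans ?_
      rw [tuple_gp]

theorem hom_ext {T : C} : ∀ {n : ℕ} {f f' : T ⟶ a.space n}, f ≫ a.pt n = f' ≫ a.pt n →
    (∀ i, f ≫ a.gp n i = f' ≫ a.gp n i) → f = f'
  | 0, f, f', h, _ => (Category.comp_id f).symm.trans (h.trans (Category.comp_id f'))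
  | n + 1, f, f', h, h' => by
    refine CartesianMonoidalCategory.hom_ext (X := a.space n) (Y := G) f f' ?_ ?_
    · refine hom_ext ?_ fun i => ?_
      · exact (Category.assoc _ _ _).trans (h.trans (Category.assoc _ _ _).symm)
      · have := h' i.castSucc
        rw [gp_castSucc] at this
        exact (Category.assoc _ _ _).trans (this.trans (Category.assoc _ _ _).symm)
    · have := h' (Fin.last n)
      rw [gp_last] at this
      exact this

theorem comp_tuple {S T : C} (f : S ⟶ T) (x : T ⟶ X) {n : ℕ} (g : Fin n → (T ⟶ G)) :
    f ≫ a.tuple x g = a.tuple (f ≫ x) (fun i => f ≫ g i) :=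
  a.hom_ext (by simp [tuple_pt]) (fun i => by simp [tuple_gp])

theorem comp_smul {S T : C} (f : S ⟶ T) (x : T ⟶ X) (g : T ⟶ G) :
    f ≫ a.smul x g = a.smul (f ≫ x) (f ≫ g) := by
  simp [smul, comp_lift_assoc]

theorem smul_smul {T : C} (x : T ⟶ X) (g h : T ⟶ G) :
    a.smul (a.smul x g) h = a.smul x (g * h) := a.act_mul x g h

theorem smul_one {T : C} (x : T ⟶ X) : a.smul x (1 : T ⟶ G) = x := a.act_one x

theorem comp_partialProd {S T : C} (f : S ⟶ T) {n : ℕ} (g : Fin n → (T ⟶ G)) (i : Fin (n + 1)) :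
    f ≫ Fin.partialProd g i = Fin.partialProd (fun j => f ≫ g j) i := by
  induction i using Fin.induction with
  | zero => simp [MonObj.comp_one]
  | succ i ih => rw [Fin.partialProd_succ, Fin.partialProd_succ, MonObj.comp_mul, ih]

/-- The structure map `[X/G]_m ⟶ [X/G]_n` of an order preserving map `σ : [n] → [m]`:
`(x, g_1, …, g_m) ↦ (x g_1 ⋯ g_{σ 0}, …, g_{σ(i-1)+1} ⋯ g_{σ(i)}, …)`. Here the product
`g_{p+1} ⋯ g_q` is written as `(g_1 ⋯ g_p)⁻¹ (g_1 ⋯ g_q)`. -/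
def structureMap {n m : ℕ} (σ : Fin (n + 1) →o Fin (m + 1)) : a.space m ⟶ a.space n :=
  a.tuple (a.smul (a.pt m) (Fin.partialProd (a.gp m) (σ 0))) fun i =>
    (Fin.partialProd (a.gp m) (σ i.castSucc))⁻¹ * Fin.partialProd (a.gp m) (σ i.succ)

theorem partialProd_structureMap {M : Type*} [Group M] {n m : ℕ} (g : Fin m → M)
    (σ : Fin (n + 1) → Fin (m + 1)) (i : Fin (n + 1)) :
    Fin.partialProd (fun i : Fin n =>
      (Fin.partialProd g (σ i.castSucc))⁻¹ * Fin.partialProd g (σ i.succ)) i =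
      (Fin.partialProd g (σ 0))⁻¹ * Fin.partialProd g (σ i) := by
  induction i using Fin.induction with
  | zero => simp
  | succ i ih => rw [Fin.partialProd_succ, ih]; group

theorem structureMap_id (n : ℕ) : a.structureMap (OrderHom.id : Fin (n + 1) →o _) = 𝟙 _ := by
  refine a.hom_ext ?_ fun i => ?_
  · rw [structureMap, tuple_pt, Category.id_comp]
    simp [smul_one]
  · rw [structureMap, tuple_gp, Category.id_comp]
    exact Fin.partialProd_right_inv _ _

theorem structureMap_comp {n m l : ℕ} (σ : Fin (n + 1) →o Fin (m + 1))
    (σ' : Fin (m + 1) →o Fin (l + 1)) :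
    a.structureMap (σ'.comp σ) = a.structureMap σ' ≫ a.structureMap σ := by
  conv_rhs => rw [structureMap.eq_def a σ, comp_tuple, comp_smul]
  simp only [MonObj.comp_mul, GrpObj.comp_inv, comp_partialProd]
  have h1 : a.structureMap σ' ≫ a.pt m = a.smul (a.pt l) (Fin.partialProd (a.gp l) (σ' 0)) :=
    a.tuple_pt _ _
  have h2 : (fun j => a.structureMap σ' ≫ a.gp m j) = fun i =>
      (Fin.partialProd (a.gp l) (σ' i.castSucc))⁻¹ * Fin.partialProd (a.gp l) (σ' i.succ) :=
    funext fun j => a.tuple_gp _ _ j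
  rw [h1, h2]
  simp only [partialProd_structureMap, smul_smul]
  simp [structureMap]

/-- The simplicial object `[X/G]_•`. -/
def simplicialSpace : SimplicialObject C where
  obj n := a.space n.unop.len
  map σ := a.structureMap σ.unop.toOrderHom
  map_id _ := a.structureMap_id _
  map_comp σ σ' := a.structureMap_comp σ'.unop.toOrderHom σ.unop.toOrderHom

/-- The inner face map `∂_{j+1}(x, g_1, …, g_{n+1}) = (x, g_1, …, g_{j+1} g_{j+2}, …, g_{n+1})`,
for `1 ≤ j + 1 ≤ n`. -/
def innerFace {n : ℕ} (j : Fin n) : a.space (n + 1) ⟶ a.space n :=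
  a.tuple (a.pt (n + 1)) (Fin.contractNth j.castSucc (· * ·) (a.gp (n + 1)))

/-- The degeneracy map `s_i(x, g_1, …, g_n) = (x, g_1, …, g_i, e, g_{i+1}, …, g_n)`. -/
def degeneracy {n : ℕ} (i : Fin (n + 1)) : a.space n ⟶ a.space (n + 1) :=
  a.tuple (a.pt n) (Fin.insertNth (α := fun _ => a.space n ⟶ G) i 1 (a.gp n))

/-- The front face map `ρ_{n,p}(x, g_1, …, g_n) = (x, g_1, …, g_p)`. -/
def front {n p : ℕ} (h : p ≤ n) : a.space n ⟶ a.space p :=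
  a.tuple (a.pt n) fun i => a.gp n (Fin.castLE h i)

/-- The back face map
`τ_{n,p}(x, g_1, …, g_n) = (x g_1 ⋯ g_{n-p}, g_{n-p+1}, …, g_n)`. -/
def back {n p : ℕ} (h : p ≤ n) : a.space n ⟶ a.space p :=
  a.tuple (a.smul (a.pt n) (Fin.partialProd (a.gp n) ⟨n - p, by omega⟩))
    fun i => a.gp n ⟨n - p + i, by omega⟩

/-- The vertex map `(x, g_1, …, g_n) ↦ x g_1 ⋯ g_p`. -/
def vertex {n p : ℕ} (h : p ≤ n) : a.space n ⟶ X :=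
  a.smul (a.pt n) (Fin.partialProd (a.gp n) ⟨p, by omega⟩)

theorem partialProd_castLE {M : Type*} [Monoid M] {n p : ℕ} (h : p ≤ n) (g : Fin n → M) :
    ∀ i : Fin (p + 1), Fin.partialProd (fun i => g (Fin.castLE h i)) i =
      Fin.partialProd g (Fin.castLE (by omega) i) := by
  intro i
  induction i using Fin.induction with
  | zero => simp
  | succ i ih =>
    rw [Fin.partialProd_succ, ih]
    exact (Fin.partialProd_succ g (Fin.castLE h i)).symm

theorem partialProd_shift {M : Type*} [Monoid M] {n p q : ℕ} (h : q + p ≤ n) (g : Fin n → M) :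
    ∀ i : Fin (p + 1), Fin.partialProd g ⟨q, by omega⟩ *
      Fin.partialProd (fun i : Fin p => g ⟨q + i, by omega⟩) i =
      Fin.partialProd g ⟨q + i, by omega⟩ := by
  intro i
  induction i using Fin.induction with
  | zero => simp
  | succ i ih =>
    rw [Fin.partialProd_succ, ← _root_.mul_assoc, ih]
    exact (Fin.partialProd_succ g ⟨q + i, by omega⟩).symm

/-- `ρ_{n,0} : [X/G]_n ⟶ [X/G]_0 = X`. -/
def frontZero (n : ℕ) : a.space n ⟶ X := a.front (Nat.zero_le n)

/-- `τ_{n,0} : [X/G]_n ⟶ [X/G]_0 = X`. -/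
def backZero (n : ℕ) : a.space n ⟶ X := a.back (Nat.zero_le n)

theorem frontZero_eq (n : ℕ) : a.frontZero n = a.pt n := rfl

theorem backZero_eq (n : ℕ) : a.backZero n = a.vertex le_rfl := rfl

theorem backZero_zero : a.backZero 0 = a.frontZero 0 := by
  rw [backZero_eq, vertex]
  exact (congrArg (a.smul (a.pt 0)) (Fin.partialProd_zero _)).trans (a.smul_one _)

theorem innerFace_front {n : ℕ} (j : Fin n) :
    a.innerFace j ≫ a.frontZero n = a.frontZero (n + 1) :=
  a.tuple_pt _ _

theorem innerFace_back {n : ℕ} (j : Fin n) :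
    a.innerFace j ≫ a.backZero n = a.backZero (n + 1) := by
  rw [backZero_eq, backZero_eq, vertex, vertex, comp_smul, comp_partialProd]
  have h2 : (fun i => a.innerFace j ≫ a.gp n i) =
      Fin.contractNth j.castSucc (· * ·) (a.gp (n + 1)) := funext fun i => a.tuple_gp _ _ i
  rw [h2, Fin.partialProd_contractNth, innerFace, tuple_pt]
  have : j.castSucc.succ.succAbove (Fin.last n) = Fin.last (n + 1) := by
    rw [Fin.succAbove_of_le_castSucc _ _ (by
      rw [Fin.le_def]; simp)]
    rfl
  exact congrArg _ (congrArg (Fin.partialProd (a.gp (n + 1))) this)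

theorem front_front {n p : ℕ} (h : p ≤ n) :
    a.front h ≫ a.frontZero p = a.frontZero n :=
  a.tuple_pt _ _

theorem front_back {n p : ℕ} (h : p ≤ n) :
    a.front h ≫ a.backZero p = a.vertex h := by
  rw [backZero_eq, vertex, vertex, comp_smul, comp_partialProd]
  have h2 : (fun i => a.front h ≫ a.gp p i) = fun i => a.gp n (Fin.castLE h i) :=
    funext fun i => a.tuple_gp _ _ i
  rw [h2, partialProd_castLE, front, tuple_pt]
  rfl

theorem back_front {n p q : ℕ} (h : p + q = n) :
    a.back (by omega : q ≤ n) ≫ a.frontZero q = a.vertex (by omega : p ≤ n) := by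
  refine (a.tuple_pt _ _).trans ?_
  subst h
  simp [vertex]

theorem back_back {n p : ℕ} (h : p ≤ n) :
    a.back h ≫ a.backZero p = a.backZero n := by
  rw [backZero_eq, backZero_eq, vertex, vertex, comp_smul, comp_partialProd]
  have h2 : (fun i => a.back h ≫ a.gp p i) = fun i : Fin p => a.gp n ⟨n - p + i, by omega⟩ :=
    funext fun i => a.tuple_gp _ _ i
  rw [h2, back, tuple_pt, smul_smul, partialProd_shift (by omega)]
  congr 2
  ext
  simp only
  omega

theorem degeneracy_front : a.degeneracy (n := 0) 0 ≫ a.frontZero 1 = 𝟙 X :=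
  a.tuple_pt _ _

theorem degeneracy_back : a.degeneracy (n := 0) 0 ≫ a.backZero 1 = 𝟙 X := by
  rw [backZero_eq, vertex, comp_smul, comp_partialProd, degeneracy, tuple_pt]
  have : (⟨1, by omega⟩ : Fin (1 + 1)) = Fin.succ 0 := rfl
  rw [this, Fin.partialProd_succ, tuple_gp]
  simp [smul_one]
  rfl

end RightAction

namespace DGPseudoFunctor

variable {k : Type w} [CommRing k] {C : Type u₁} [Category.{v₁} C]

section PullHom

variable (F : DGPseudoFunctor.{w, v, u, v₁, u₁} k C)

/-- The dg-functor `f^* : F̃(Y) → F̃(Z)` of a morphism `f : Z ⟶ Y`. -/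
def pull {Z Y : C} (f : Z ⟶ Y) : F.rect Y ⟶ F.rect Z := F.rectification.map f.op

theorem pull_pull_obj {Z Y X : C} (f : Z ⟶ Y) (s : Y ⟶ X) (s' : Z ⟶ X) (h : f ≫ s = s')
    (E : (F.rect X).Obj) : (F.pull f).obj ((F.pull s).obj E) = (F.pull s').obj E := by
  subst h
  exact (congrArg (fun H : F.rect X ⟶ F.rect Z => H.obj E)
    (F.rectification.map_comp s.op f.op)).symm

/-- The map `f^* : Hom(s^* E, t^* E') → Hom((s f)^* E, (t f)^* E')`, where `f^* s^* = (s f)^*`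
and `f^* t^* = (t f)^*` are used as strict equalities. -/
def pullHom {Z Y X : C} (f : Z ⟶ Y) {s t : Y ⟶ X} {s' t' : Z ⟶ X} (hs : f ≫ s = s')
    (ht : f ≫ t = t') {E E' : (F.rect X).Obj} {n : ℤ} :
    (F.rect Y).Hom ((F.pull s).obj E) ((F.pull t).obj E') n →ₗ[k]
      (F.rect Z).Hom ((F.pull s').obj E) ((F.pull t').obj E') n :=
  ((F.rect Z).castHom (F.pull_pull_obj f s s' hs E) (F.pull_pull_obj f t t' ht E') rfl).comp
    (F.pull f).map

end PullHom

section Equivariant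

variable [CartesianMonoidalCategory C] {X G : C} [GrpObj G]
  (F : DGPseudoFunctor.{w, v, u, v₁, u₁} k C) (a : RightAction X G)

/-- `Hom^r(τ_{n,0}^* E, ρ_{n,0}^* E')` in `F̃([X/G]_n)`. -/
abbrev EqvComponent (n : ℕ) (E E' : (F.rect X).Obj) (r : ℤ) : Type (max u₁ v₁ v) :=
  (F.rect (a.space n)).Hom ((F.pull (a.backZero n)).obj E) ((F.pull (a.frontZero n)).obj E') r

variable {F a}

/-- `∂_{j+1}^* θ` for `θ` on `[X/G]_n` and `1 ≤ j + 1 ≤ n`. -/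
def facePull {n : ℕ} (j : Fin n) {E E' : (F.rect X).Obj} {r : ℤ}
    (θ : EqvComponent F a n E E' r) : EqvComponent F a (n + 1) E E' r :=
  F.pullHom (a.innerFace j) (a.innerFace_back j) (a.innerFace_front j) θ

/-- `ρ_{n,p}^* θ ∘ τ_{n,q}^* η` for `θ` on `[X/G]_p` and `η` on `[X/G]_q`, where `n = p + q`. -/
def cupTerm {n p q : ℕ} (h : p + q = n) {E E' E'' : (F.rect X).Obj} {r s t : ℤ}
    (hr : r + s = t) (θ : EqvComponent F a p E' E'' r) (η : EqvComponent F a q E E' s) :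
    EqvComponent F a n E E'' t :=
  (F.rect (a.space n)).comp hr
    (F.pullHom (a.front (by omega : p ≤ n)) (a.front_back _) (a.front_front _) θ)
    (F.pullHom (a.back (by omega : q ≤ n)) (a.back_back _) (a.back_front h) η)

variable (F a)

/-- A `G`-equivariant twisted object: an object `E` of `F̃(X)` with
`φ^{n,1-n} ∈ Hom^{1-n}(τ_{n,0}^* E, ρ_{n,0}^* E)` for `n ≥ 1` which satisfy the Maurer-Cartan
equation (here in simplicial degree `n + 1`) and the non-degeneracy condition, and also, with the
normalized convention, `s_0^* φ^{1,0} = id` and `s_i^* φ^{n,1-n} = 0` for `n ≥ 2`. -/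
structure EqvObj (c : DegeneracyConvention) where
  E : (F.rect X).Obj
  φ : ∀ n : ℕ, 1 ≤ n → EqvComponent F a n E E (1 - n)
  maurerCartan : ∀ n : ℕ,
    ((n + 1 : ℕ) : ℤ).negOnePow •
        (F.rect (a.space (n + 1))).d (by push_cast; omega) (φ (n + 1) (by omega)) +
      ∑ j : Fin n, ((j + 1 : ℕ) : ℤ).negOnePow • facePull j (φ n (by have := j.2; omega)) +
      ∑ j : Fin n, ((1 - (j + 1 : ℕ)) * ((n + 1 : ℕ) - (j + 1 : ℕ)) : ℤ).negOnePow •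
        cupTerm (by have := j.2; omega) (by have := j.2; omega)
          (φ (j + 1) (by omega)) (φ (n - j) (by have := j.2; omega)) =
      (0 : EqvComponent F a (n + 1) E E (1 - n))
  nondegenerate : (F.rect (a.space 1)).HomotopyInvertible (by simp) (φ 1 le_rfl)
  normalized : c = .normalized →
    F.pullHom (a.degeneracy (n := 0) 0) a.degeneracy_back a.degeneracy_front (φ 1 le_rfl) =
      (F.rect X).castHom rfl rfl (by simp) ((F.rect X).id ((F.pull (𝟙 X)).obj E)) ∧
    ∀ (n : ℕ) (i : Fin (n + 2)),
      (F.pull (a.degeneracy i)).map (φ (n + 2) (by omega)) = 0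

variable {F a} {c : DegeneracyConvention}

/-- The degree `m` morphisms between `G`-equivariant twisted objects: collections
`θ^{n,m-n} ∈ Hom^{m-n}(τ_{n,0}^* E, ρ_{n,0}^* E')` for `n ≥ 0`. -/
abbrev EqvHom (x y : EqvObj F a c) (m : ℤ) : Type (max u₁ v₁ v) :=
  ∀ n : ℕ, EqvComponent F a n x.E y.E (m - n)

namespace EqvHom

/-- The sum `∑_{0<j<n} (-1)^j ∂_j^* θ^{n-1,m+1-n}`. -/
def faceSum {x y : EqvObj F a c} {m m' : ℤ} (h : m + 1 = m') (θ : EqvHom x y m) :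
    ∀ n : ℕ, EqvComponent F a n x.E y.E (m' - n)
  | 0 => 0
  | n + 1 => ∑ j : Fin n, ((j + 1 : ℕ) : ℤ).negOnePow •
      (F.rect (a.space (n + 1))).castHom rfl rfl (by push_cast; omega) (facePull j (θ n))

/-- The differential: `(dθ)^{n,m+1-n}` is
`(-1)^n d θ^{n,m-n} + ∑_{0<j<n} (-1)^j ∂_j^* θ^{n-1,m+1-n}
  + ∑_{1≤l≤n} (-1)^{(1-l)(n-l)} ρ_{n,l}^* ψ^{l,1-l} τ_{n,n-l}^* θ^{n-l,m-n+l}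
  - (-1)^m ∑_{0≤l<n} (-1)^{(m-l)(n-l)} ρ_{n,l}^* θ^{l,m-l} τ_{n,n-l}^* φ^{n-l,1-n+l}`
for `θ : (E, φ) → (E', ψ)` of degree `m`. -/
def d {x y : EqvObj F a c} {m m' : ℤ} (h : m + 1 = m') (θ : EqvHom x y m) : EqvHom x y m' :=
  fun n =>
    (n : ℤ).negOnePow • (F.rect (a.space n)).d (by omega) (θ n) + faceSum h θ n +
      ∑ l : Fin n, ((1 - (l + 1 : ℕ)) * (n - (l + 1 : ℕ)) : ℤ).negOnePow •
        cupTerm (by have := l.2; omega) (by have := l.2; omega)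
          (y.φ (l + 1) (by omega)) (θ (n - (l + 1))) -
      m.negOnePow • ∑ l : Fin n, ((m - (l : ℕ)) * (n - (l : ℕ)) : ℤ).negOnePow •
        cupTerm (by have := l.2; omega) (by have := l.2; omega)
          (θ l) (x.φ (n - l) (by have := l.2; omega))

/-- The composition, by the shuffled multiplication
`(θ · η)^n = ∑_{0≤l≤n} (-1)^{(p-l)(n-l)} ρ_{n,l}^* θ^{l,p-l} τ_{n,n-l}^* η^{n-l}`. -/
def comp {x y z : EqvObj F a c} {p q m : ℤ} (h : p + q = m) (θ : EqvHom y z p)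
    (η : EqvHom x y q) : EqvHom x z m :=
  fun n => ∑ l : Fin (n + 1), ((p - (l : ℕ)) * (n - (l : ℕ)) : ℤ).negOnePow •
    cupTerm (by have := l.2; omega) (by have := l.2; omega) (θ l) (η (n - l))

/-- The identity morphism; note that `τ_{0,0} = ρ_{0,0} = id_X`. -/
def id (x : EqvObj F a c) : EqvHom x x 0
  | 0 => (F.rect X).castHom rfl
      (congrArg (fun f => (F.pull f).obj x.E) a.backZero_zero) (by simp)
      ((F.rect X).id ((F.pull (a.backZero 0)).obj x.E))
  | _ + 1 => 0

end EqvHom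

end Equivariant

end DGPseudoFunctor

namespace DGCat

open scoped Simplicial

variable {k : Type w} [CommRing k] {c : DegeneracyConvention}
  {B : CosimplicialObject (DGCat.{w, v, u} k)}

/-- The component `(E^n, φ^n)` in `Δ_n(B^n)` of an object of the totalization. -/
def Tot.component (x : (Tot c B).Obj) (n : ℕ) : SimplexObj c (B.obj ⦋n⦌) n := x.1 n

/-- The component in `Δ_n(B^n)` of a morphism of the totalization. -/
def Tot.homComponent {x y : (Tot c B).Obj} {m : ℤ} (θ : (Tot c B).Hom x y m) (n : ℕ) :
    Coch (B.obj ⦋n⦌) (Tot.component x n).E (Tot.component y n).E m := θ.1 n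

end DGCat

/-- The cosimplicial dg-category `F̃([X/G]_•)`. -/
def RightAction.cosimplicial {k : Type w} [CommRing k] {C : Type u₁} [Category.{v₁} C]
    [CartesianMonoidalCategory C] {X G : C} [GrpObj G] (a : RightAction X G)
    (F : DGPseudoFunctor.{w, v, u, v₁, u₁} k C) :
    CosimplicialObject (DGCat.{w, max u₁ v₁ v, max u₁ v₁ u v} k) :=
  a.simplicialSpace.rightOp ⋙ F.rectification

/-!
The equalizer condition says that the families `E^n`, `φ_n`, `θ_n` are compatible with all
structure maps of the cosimplicial dg-category. A multi-index `I` in `[n]` of length `q + 1` is an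
order preserving map `[q] → [n]`, so compatibility determines `θ_n` at `I` as the image under `I`
of `θ_q` at the identity `0 1 … q`, and it imposes no other condition: a compatible family is an
arbitrary sequence of components at `0 1 … n`. The equations for these components only involve the
restrictions of `0 1 … n` to its front faces, back faces and inner faces, which for `[X/G]_•` are
the pullbacks along `ρ`, `τ` and `∂_j`, since a map `[X/G]_m → [X/G]_n` is a structure map as soon
as it acts correctly on the base point and on the partial products of the group coordinates.
Finally, a multi-index with a repetition factors through some codegeneracy `[q + 1] → [q]`, so that
the normalization (N) reduces to the vanishing of the `s_i^*φ`.
-/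

namespace DGCat

variable {k : Type w} [CommRing k]

section CastHom

variable (C : DGCat.{w, v, u} k) {x x' x'' y y' y'' : C.Obj} {n n' n'' : ℤ}

theorem castHom_castHom (hx : x = x') (hx' : x' = x'') (hy : y = y') (hy' : y' = y'')
    (hn : n = n') (hn' : n' = n'') (f : C.Hom x y n) :
    C.castHom hx' hy' hn' (C.castHom hx hy hn f) =
      C.castHom (hx.trans hx') (hy.trans hy') (hn.trans hn') f := by
  subst hx hy hn; rfl

theorem castHom_heq (hx : x = x') (hy : y = y') (hn : n = n') (f : C.Hom x y n) :
    HEq (C.castHom hx hy hn f) f := by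
  subst hx hy hn; rfl

theorem castHom_castHom_id {r : ℤ} (hx : x = x') (hy : x = y) (hr : 0 = r) :
    C.castHom hx hy rfl (C.castHom rfl rfl hr (C.id x)) =
      C.castHom rfl (hx.symm.trans hy) hr (C.id x') := by
  subst hx hy hr; rfl

variable {C} in
theorem castHom_inj (hx : x = x') (hy : y = y') (hn : n = n') {f g : C.Hom x y n} :
    C.castHom hx hy hn f = C.castHom hx hy hn g ↔ f = g := by
  subst hx hy hn; rfl

variable {C} in
theorem castHom_eq_zero_iff (hx : x = x') (hy : y = y') (hn : n = n') {f : C.Hom x y n} :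
    C.castHom hx hy hn f = 0 ↔ f = 0 := by
  subst hx hy hn; rfl

variable {C} in
theorem homotopyInvertible_castHom_iff (hx : x = x') (hy : y = y') (hn : n = n') {h₀ : n = 0}
    {h₀' : n' = 0} {f : C.Hom x y n} :
    C.HomotopyInvertible h₀' (C.castHom hx hy hn f) ↔ C.HomotopyInvertible h₀ f := by
  subst hx hy hn; rfl

/-- Transport of morphisms along equalities of source, target and degree, as an isomorphism. -/
def castEquiv (hx : x = x') (hy : y = y') (hn : n = n') : C.Hom x y n ≃ₗ[k] C.Hom x' y' n' :=
  LinearEquiv.ofLinearMap (C.castHom hx hy hn) (C.castHom hx.symm hy.symm hn.symm)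
    (LinearMap.ext fun f => C.castHom_castHom _ _ _ _ _ _ f)
    (LinearMap.ext fun f => C.castHom_castHom _ _ _ _ _ _ f)

end CastHom

theorem cochains_castHom_apply (C : DGCat.{w, v, u} k) {N : ℕ} {E E' F F' : Fin (N + 1) → C.Obj}
    {m : ℤ} (hE : E = E') (hF : F = F') (θ : Coch C E F m) (q : ℕ)
    (I : Fin (q + 1) →o Fin (N + 1)) :
    ((C.cochains N).castHom hE hF rfl θ : Coch C E' F' m) q I =
      C.castHom (congrFun hE _) (congrFun hF _) rfl (θ q I) := by
  subst hE hF; rfl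

section Cosimplicial

open scoped Simplicial

variable {B : CosimplicialObject (DGCat.{w, v, u} k)}

variable (B) in
/-- The dg-functor `B^l → B^n` of an order preserving map `[l] → [n]`, with the latter unbundled
from the simplex category so that it can be applied to multi-indices. -/
def transition {l n : ℕ} (I : Fin (l + 1) →o Fin (n + 1)) : B.obj ⦋l⦌ ⟶ B.obj ⦋n⦌ :=
  B.map (SimplexCategory.Hom.mk I)

variable (B) in
theorem transition_id (n : ℕ) :
    transition B (OrderHom.id : Fin (n + 1) →o Fin (n + 1)) = 𝟙 (B.obj ⦋n⦌) :=
  B.map_id _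

variable (B) in
theorem transition_comp {l m n : ℕ} (I : Fin (m + 1) →o Fin (n + 1))
    (J : Fin (l + 1) →o Fin (m + 1)) :
    transition B (I.comp J) = transition B J ≫ transition B I :=
  B.map_comp (SimplexCategory.Hom.mk J) (SimplexCategory.Hom.mk I)

/-- The objects `E^n_i` of `B^n`, for `0 ≤ i ≤ n`, underlying an object of the totalization whose
vertex in `B^0` is `E`: the images of `E` under the maps `[0] → [n]` with value `i`. They are
given up to equality only, since the totalization supplies them in another form. -/
structure VertexFamily (E : (B.obj ⦋0⦌).Obj) where
  obj : ∀ n : ℕ, Fin (n + 1) → (B.obj ⦋n⦌).Obj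
  obj_eq : ∀ n i, obj n i = (transition B (OrderHom.const (Fin 1) i)).obj E

theorem exists_castSucc_eq_succ {q n : ℕ} (I : Fin (q + 1) →o Fin n)
    (hI : ¬ Function.Injective I) : ∃ i : Fin q, I i.castSucc = I i.succ := by
  by_contra! h
  exact hI (Fin.strictMono_iff_lt_succ.2 fun i =>
    lt_of_le_of_ne (I.monotone i.castSucc_lt_succ.le) (h i)).injective

theorem eq_comp_predAboveOrderHom {q n : ℕ} (I : Fin (q + 2) →o Fin n) {i : Fin (q + 1)}
    (hi : I i.castSucc = I i.succ) :
    I = (I.comp (Fin.succAboveOrderEmb i.castSucc).toOrderHom).comp (Fin.predAboveOrderHom i) := by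
  refine OrderHom.ext _ _ (funext fun j => ?_)
  change I j = I (i.castSucc.succAbove (i.predAbove j))
  by_cases hj : j = i.castSucc
  · rw [hj, Fin.predAbove_castSucc_self, Fin.succAbove_castSucc_self, hi]
  · rw [Fin.succAbove_predAbove hj]

namespace VertexFamily

variable {E E' E'' : (B.obj ⦋0⦌).Obj}

/-- The vertex family of `E` formed by the images of `E` themselves. -/
def standard (E : (B.obj ⦋0⦌).Obj) : VertexFamily E where
  obj _ i := (transition B (OrderHom.const (Fin 1) i)).obj E
  obj_eq _ _ := rfl

theorem obj_zero_zero (U : VertexFamily E) : U.obj 0 0 = E := by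
  have h : OrderHom.const (Fin 1) (0 : Fin 1) = OrderHom.id :=
    OrderHom.ext _ _ (funext fun _ => Subsingleton.elim _ _)
  rw [U.obj_eq, h, transition_id]
  rfl

theorem transition_obj (U : VertexFamily E) {l n : ℕ} (I : Fin (l + 1) →o Fin (n + 1))
    (i : Fin (l + 1)) : (transition B I).obj (U.obj l i) = U.obj n (I i) := by
  rw [U.obj_eq, U.obj_eq]
  exact (congrArg (fun H => DGFunctor.obj H E) (transition_comp B I _)).symm

variable (U : VertexFamily E) (V : VertexFamily E') (W : VertexFamily E'')

/-- The map `Hom(E^l_i, F^l_j) → Hom(E^n_{I i}, F^n_{I j})` induced by `I : [l] → [n]`. -/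
def pushHom {l n : ℕ} (I : Fin (l + 1) →o Fin (n + 1)) {i j : Fin (l + 1)} {r : ℤ} :
    (B.obj ⦋l⦌).Hom (U.obj l i) (V.obj l j) r →ₗ[k]
      (B.obj ⦋n⦌).Hom (U.obj n (I i)) (V.obj n (I j)) r :=
  ((B.obj ⦋n⦌).castHom (U.transition_obj I i) (V.transition_obj I j) rfl).comp
    (transition B I).map

theorem pushHom_id {n : ℕ} {i j : Fin (n + 1)} {r : ℤ}
    (f : (B.obj ⦋n⦌).Hom (U.obj n i) (V.obj n j) r) : U.pushHom V OrderHom.id f = f := by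
  have h : ∀ {H : B.obj ⦋n⦌ ⟶ B.obj ⦋n⦌} (_ : H = 𝟙 _) (hi : H.obj _ = _) (hj : H.obj _ = _),
      (B.obj ⦋n⦌).castHom hi hj rfl (H.map f) = f := by
    rintro _ rfl _ _; rfl
  exact h (transition_id B n) _ _

theorem pushHom_comp {l m n : ℕ} (I : Fin (m + 1) →o Fin (n + 1))
    (J : Fin (l + 1) →o Fin (m + 1)) {i j : Fin (l + 1)} {r : ℤ}
    (f : (B.obj ⦋l⦌).Hom (U.obj l i) (V.obj l j) r) :
    U.pushHom V (I.comp J) f = U.pushHom V I (U.pushHom V J f) := by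
  have h : ∀ {H : B.obj ⦋l⦌ ⟶ B.obj ⦋n⦌} (_ : H = transition B J ≫ transition B I)
      (hi : H.obj _ = _) (hj : H.obj _ = _),
      (B.obj ⦋n⦌).castHom hi hj rfl (H.map f) = U.pushHom V I (U.pushHom V J f) := by
    rintro _ rfl _ _
    simp only [pushHom, LinearMap.comp_apply, map_castHom, castHom_castHom]
    rfl
  exact h (transition_comp B I J) _ _

theorem pushHom_castHom_id {l n : ℕ} (I : Fin (l + 1) →o Fin (n + 1)) (i : Fin (l + 1)) {r : ℤ}
    (hr : 0 = r) :
    U.pushHom U I ((B.obj ⦋l⦌).castHom rfl rfl hr ((B.obj ⦋l⦌).id (U.obj l i))) =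
      (B.obj ⦋n⦌).castHom rfl rfl hr ((B.obj ⦋n⦌).id (U.obj n (I i))) := by
  rw [pushHom, LinearMap.comp_apply, map_castHom, castHom_castHom, DGFunctor.map_id,
    ← castHom_id _ (U.transition_obj I i), castHom_castHom]

theorem castHom_pushHom {D D' : (B.obj ⦋0⦌).Obj} (U' : VertexFamily D) (V' : VertexFamily D')
    {l n : ℕ} (I : Fin (l + 1) →o Fin (n + 1)) {i j : Fin (l + 1)} {r : ℤ}
    (hi : U.obj l i = U'.obj l i) (hj : V.obj l j = V'.obj l j)
    (hi' : U.obj n (I i) = U'.obj n (I i)) (hj' : V.obj n (I j) = V'.obj n (I j))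
    (f : (B.obj ⦋l⦌).Hom (U.obj l i) (V.obj l j) r) :
    (B.obj ⦋n⦌).castHom hi' hj' rfl (U.pushHom V I f) =
      U'.pushHom V' I ((B.obj ⦋l⦌).castHom hi hj rfl f) := by
  simp only [pushHom, LinearMap.comp_apply, map_castHom, castHom_castHom]

variable {U V} in
theorem homotopyInvertible_pushHom {l n : ℕ} (I : Fin (l + 1) →o Fin (n + 1))
    {i j : Fin (l + 1)} {r : ℤ} {hr : r = 0} {f : (B.obj ⦋l⦌).Hom (U.obj l i) (V.obj l j) r}
    (hf : (B.obj ⦋l⦌).HomotopyInvertible hr f) :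
    (B.obj ⦋n⦌).HomotopyInvertible hr (U.pushHom V I f) :=
  (homotopyInvertible_castHom_iff _ _ rfl).2 (hf.map (transition B I))

/-- The families of cochains `θ_n` on `B^n` that commute with the structure functors; between the
vertex families of two objects of the totalization, these are the morphisms there. -/
def compatibleCochains (m : ℤ) :
    Submodule k (∀ n : ℕ, Coch (B.obj ⦋n⦌) (U.obj n) (V.obj n) m) where
  carrier := {θ | ∀ (l n : ℕ) (I : Fin (l + 1) →o Fin (n + 1)) (q : ℕ)
    (J : Fin (q + 1) →o Fin (l + 1)), θ n q (I.comp J) = U.pushHom V I (θ l q J)}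
  zero_mem' := fun _ _ _ _ _ => (map_zero _).symm
  add_mem' := fun hθ hη l n I q J =>
    (congrArg₂ (· + ·) (hθ l n I q J) (hη l n I q J)).trans (map_add _ _ _).symm
  smul_mem' := fun a _ hθ l n I q J =>
    (congrArg (a • ·) (hθ l n I q J)).trans (map_smul _ _ _).symm

variable {U V W} {m m' p q : ℤ}

theorem mem_compatibleCochains_iff {θ : ∀ n : ℕ, Coch (B.obj ⦋n⦌) (U.obj n) (V.obj n) m} :
    θ ∈ U.compatibleCochains V m ↔ ∀ (l n : ℕ) (I : Fin (l + 1) →o Fin (n + 1)),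
      ((B.obj ⦋n⦌).cochains l).castHom (funext (U.transition_obj I)) (funext (V.transition_obj I))
        rfl (Coch.map (transition B I) (θ l)) = Coch.restrict I (θ n) := by
  refine forall₃_congr fun l n I => ⟨fun h => ?_, fun h q J => ?_⟩
  · funext q J
    exact (cochains_castHom_apply ..).trans (h q J).symm
  · exact ((cochains_castHom_apply ..).symm.trans (congrFun (congrFun h q) J)).symm

theorem diff_mem_compatibleCochains (h : m + 1 = m')
    {θ : ∀ n : ℕ, Coch (B.obj ⦋n⦌) (U.obj n) (V.obj n) m} (hθ : θ ∈ U.compatibleCochains V m) :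
    (fun n => Coch.diff h (θ n)) ∈ U.compatibleCochains V m' := by
  rw [mem_compatibleCochains_iff] at hθ ⊢
  intro l n I
  rw [Coch.map_diff]
  refine (castHom_d ((B.obj ⦋n⦌).cochains l) _ _ rfl rfl h _).trans ?_
  rw [hθ]
  rfl

theorem mul_mem_compatibleCochains (h : p + q = m)
    {θ : ∀ n : ℕ, Coch (B.obj ⦋n⦌) (V.obj n) (W.obj n) p} (hθ : θ ∈ V.compatibleCochains W p)
    {η : ∀ n : ℕ, Coch (B.obj ⦋n⦌) (U.obj n) (V.obj n) q} (hη : η ∈ U.compatibleCochains V q) :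
    (fun n => Coch.mul h (θ n) (η n)) ∈ U.compatibleCochains W m := by
  rw [mem_compatibleCochains_iff] at hθ hη ⊢
  intro l n I
  rw [Coch.map_mul]
  refine (castHom_comp ((B.obj ⦋n⦌).cochains l) _ (funext (V.transition_obj I)) _ rfl rfl rfl h
    _ _).trans ?_
  rw [hθ, hη]
  rfl

/-- The curvature `D φ + φ · φ` of a compatible family of twisting cochains, whose vanishing is the
Maurer-Cartan equation. -/
noncomputable def curvature (φ : U.compatibleCochains U 1) : U.compatibleCochains U 2 :=
  ⟨_, diff_mem_compatibleCochains (by omega) φ.2⟩ +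
    ⟨_, mul_mem_compatibleCochains (by omega) φ.2 φ.2⟩

variable (U V m) in
/-- A compatible family of cochains is determined by its components at the multi-indices
`0 1 … n`, which can be prescribed arbitrarily: the component at `I : [q] → [n]` is the image under
`I` of the one at `0 1 … q`. -/
def topEquiv : U.compatibleCochains V m ≃ₗ[k]
    ∀ n : ℕ, (B.obj ⦋n⦌).Hom (U.obj n (Fin.last n)) (V.obj n 0) (m - n) where
  toFun θ n := θ.1 n n OrderHom.id
  map_add' _ _ := rfl
  map_smul' _ _ := rfl
  invFun t := ⟨fun _ q I => U.pushHom V I (t q), fun _ _ I _ J => pushHom_comp U V I J _⟩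
  left_inv θ := Subtype.ext <| funext fun n => funext fun q => funext fun I =>
    (θ.2 q n I q OrderHom.id).symm
  right_inv _ := funext fun _ => pushHom_id U V _

theorem apply_eq_pushHom {θ : ∀ n : ℕ, Coch (B.obj ⦋n⦌) (U.obj n) (V.obj n) m}
    (hθ : θ ∈ U.compatibleCochains V m) (n q : ℕ) (I : Fin (q + 1) →o Fin (n + 1)) :
    θ n q I = U.pushHom V I (θ q q OrderHom.id) :=
  hθ q n I q OrderHom.id

theorem apply_eq_id_of_const {θ : ∀ n : ℕ, Coch (B.obj ⦋n⦌) (U.obj n) (U.obj n) 1}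
    (hθ : θ ∈ U.compatibleCochains U 1)
    (h : θ 0 1 (OrderHom.const _ 0) =
      (B.obj ⦋0⦌).castHom rfl rfl (by simp) ((B.obj ⦋0⦌).id (U.obj 0 0)))
    {n : ℕ} (I : Fin 2 →o Fin (n + 1)) (hI : I 0 = I (Fin.last 1)) :
    θ n 1 I = (B.obj ⦋n⦌).castHom (congrArg (U.obj n) hI) rfl (by simp)
      ((B.obj ⦋n⦌).id (U.obj n (I 0))) := by
  obtain ⟨J, hJ⟩ : ∃ J : Fin 1 →o Fin (n + 1), I = J.comp (OrderHom.const (Fin 2) 0) :=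
    ⟨OrderHom.const _ (I 0), OrderHom.ext _ _ (funext fun i => by
      fin_cases i
      exacts [rfl, hI.symm])⟩
  subst hJ
  exact (hθ 0 n J 1 (OrderHom.const _ 0)).trans ((congrArg _ h).trans (U.pushHom_castHom_id J 0 _))

theorem apply_eq_zero_of_not_injective {θ : ∀ n : ℕ, Coch (B.obj ⦋n⦌) (U.obj n) (V.obj n) m}
    (hθ : θ ∈ U.compatibleCochains V m) {q : ℕ}
    (h : ∀ i : Fin (q + 1), θ q (q + 1) (Fin.predAboveOrderHom i) = 0)
    {n : ℕ} (I : Fin (q + 2) →o Fin (n + 1)) (hI : ¬ Function.Injective I) :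
    θ n (q + 1) I = 0 := by
  obtain ⟨i, hi⟩ := exists_castSucc_eq_succ I hI
  obtain ⟨J, rfl⟩ : ∃ J : Fin (q + 1) →o Fin (n + 1), I = J.comp (Fin.predAboveOrderHom i) :=
    ⟨_, eq_comp_predAboveOrderHom I hi⟩
  exact (hθ q n J (q + 1) (Fin.predAboveOrderHom i)).trans ((congrArg _ (h i)).trans (map_zero _))

end VertexFamily

theorem pi_castHom_apply {ι : Type} (C : ι → DGCat.{w, v, u} k) {x x' y y' : (pi C).Obj} {n : ℤ}
    (hx : x = x') (hy : y = y') (f : (pi C).Hom x y n) (i : ι) :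
    (pi C).castHom hx hy rfl f i = (C i).castHom (congrFun hx i) (congrFun hy i) rfl (f i) := by
  subst hx hy; rfl

section Simplex

variable {c : DegeneracyConvention} {C : DGCat.{w, v, u} k} {N : ℕ}

theorem simplex_castHom {x x' y y' : SimplexObj c C N} {m : ℤ} (hx : x = x') (hy : y = y')
    (θ : Coch C x.E y.E m) :
    (simplex c C N).castHom hx hy rfl θ =
      (C.cochains N).castHom (congrArg SimplexObj.E hx) (congrArg SimplexObj.E hy) rfl θ := by
  subst hx hy; rfl

theorem SimplexObj.castHom_φ {x y : SimplexObj c C N} (h : x = y) :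
    (C.cochains N).castHom (congrArg SimplexObj.E h) (congrArg SimplexObj.E h) rfl x.φ = y.φ := by
  subst h; rfl

theorem SimplexObj.ext_of_castHom {x y : SimplexObj c C N} (hE : x.E = y.E)
    (hφ : (C.cochains N).castHom hE hE rfl x.φ = y.φ) : x = y := by
  obtain ⟨E, φ, _, _, _, _⟩ := x
  obtain ⟨E', φ', _, _, _, _⟩ := y
  change E = E' at hE
  subst hE
  change φ = φ' at hφ
  subst hφ
  rfl

end Simplex

namespace Tot

open VertexFamily

variable {c : DegeneracyConvention}

theorem map_component_eq_restrict (x : (Tot c B).Obj) {l n : ℕ}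
    (I : Fin (l + 1) →o Fin (n + 1)) :
    SimplexObj.map (transition B I) (component x l) = SimplexObj.restrict I (component x n) :=
  congrFun x.2 ⟨l, n, SimplexCategory.Hom.mk I⟩

/-- The objects of `B^n` underlying an object of the totalization. -/
def vertexFamily (x : (Tot c B).Obj) : VertexFamily ((component x 0).E 0) where
  obj n := (component x n).E
  obj_eq _ i := (congrFun (congrArg SimplexObj.E
    (map_component_eq_restrict x (OrderHom.const (Fin 1) i))) 0).symm

/-- The twisting cochains `φ_n` of an object of the totalization, as one compatible family. -/
def twistingCochain (x : (Tot c B).Obj) :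
    (vertexFamily x).compatibleCochains (vertexFamily x) 1 :=
  ⟨fun n => (component x n).φ, mem_compatibleCochains_iff.2 fun _ _ I =>
    SimplexObj.castHom_φ (map_component_eq_restrict x I)⟩

/-- The morphisms of the totalization are the compatible families of cochains. -/
noncomputable def homEquiv (x y : (Tot c B).Obj) (m : ℤ) :
    (Tot c B).Hom x y m ≃ₗ[k] (vertexFamily x).compatibleCochains (vertexFamily y) m :=
  LinearEquiv.ofEq _ _ <| Submodule.ext fun θ => by
    refine Iff.trans ?_ mem_compatibleCochains_iff.symm
    refine ⟨fun h l n I => ?_, fun h => ?_⟩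
    · exact (simplex_castHom _ _ _).symm.trans ((pi_castHom_apply _ x.2 y.2 _ _).symm.trans
        (congrFun h ⟨l, n, SimplexCategory.Hom.mk I⟩))
    · exact funext fun σ => (pi_castHom_apply _ x.2 y.2 _ _).trans
        ((simplex_castHom _ _ _).trans (h σ.1 σ.2.1 σ.2.2.toOrderHom))

theorem ext {x y : (Tot c B).Obj} (hE : (component x 0).E 0 = (component y 0).E 0)
    (hφ : ∀ n : ℕ, 1 ≤ n →
      HEq ((component x n).φ n OrderHom.id) ((component y n).φ n OrderHom.id)) : x = y := by
  have hobj : ∀ n, (component x n).E = (component y n).E := fun n => funext fun i =>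
    ((vertexFamily x).obj_eq n i).trans
      ((congrArg _ hE).trans ((vertexFamily y).obj_eq n i).symm)
  have htop : ∀ n, (B.obj ⦋n⦌).castHom (congrFun (hobj n) _) (congrFun (hobj n) _) rfl
      ((component x n).φ n OrderHom.id) = (component y n).φ n OrderHom.id := by
    rintro (_ | n)
    · exact (congrArg _ ((component x 0).φ_zero _)).trans
        ((map_zero _).trans ((component y 0).φ_zero _).symm)
    · exact eq_of_heq ((castHom_heq ..).trans (hφ (n + 1) (by omega)))
  refine Subtype.ext (funext fun n => SimplexObj.ext_of_castHom (hobj n) ?_)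
  funext q I
  refine (cochains_castHom_apply ..).trans ?_
  exact (congrArg _ (apply_eq_pushHom (twistingCochain x).2 n q I)).trans
    ((castHom_pushHom (vertexFamily x) (vertexFamily x) (vertexFamily y) (vertexFamily y) I
      (congrFun (hobj q) _) (congrFun (hobj q) _) _ _ _).trans ((congrArg _ (htop q)).trans
      (apply_eq_pushHom (twistingCochain y).2 n q I).symm))

/-- The object of the totalization given by a compatible family of twisting cochains. Invertibility
and normalization need to be imposed on the components at `0 1` and at the elementary degenerate
multi-indices `0 1 … i i … n` only. -/
noncomputable def mk {E : (B.obj ⦋0⦌).Obj} (U : VertexFamily E) (φ : U.compatibleCochains U 1)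
    (φ_zero : φ.1 0 0 OrderHom.id = 0) (curvature_eq_zero : curvature φ = 0)
    (invertible : (B.obj ⦋1⦌).HomotopyInvertible (by simp) (φ.1 1 1 OrderHom.id))
    (normalized : c = .normalized →
      φ.1 0 1 (OrderHom.const _ 0) =
        (B.obj ⦋0⦌).castHom rfl rfl (by simp) ((B.obj ⦋0⦌).id (U.obj 0 0)) ∧
      ∀ (n : ℕ) (i : Fin (n + 2)), φ.1 (n + 1) (n + 2) (Fin.predAboveOrderHom i) = 0) :
    (Tot c B).Obj :=
  ⟨fun n =>
    { E := U.obj n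
      φ := φ.1 n
      φ_zero := fun I =>
        (apply_eq_pushHom φ.2 n 0 I).trans ((congrArg _ φ_zero).trans (map_zero _))
      maurerCartan := congrFun (congrArg Subtype.val curvature_eq_zero) n
      invertible := fun I => by
        rw [apply_eq_pushHom φ.2]
        exact homotopyInvertible_pushHom I invertible
      normalized := fun hc => ⟨apply_eq_id_of_const φ.2 (normalized hc).1,
        fun q I hq hI => by
          obtain ⟨q, rfl⟩ := Nat.exists_eq_add_of_le' hq
          exact apply_eq_zero_of_not_injective φ.2 ((normalized hc).2 q) I hI⟩ },
    funext fun σ => SimplexObj.ext_of_castHom (funext (U.transition_obj σ.2.2.toOrderHom))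
      (mem_compatibleCochains_iff.1 φ.2 _ _ σ.2.2.toOrderHom)⟩

end Tot

end Cosimplicial

end DGCat

namespace RightAction

open MonoidalCategory CartesianMonoidalCategory MonObj

variable {C : Type u₁} [Category.{v₁} C] [CartesianMonoidalCategory C] {X G : C} [GrpObj G]
  (a : RightAction X G)

theorem eq_structureMap {n m : ℕ} (σ : Fin (n + 1) →o Fin (m + 1)) (f : a.space m ⟶ a.space n)
    (hpt : f ≫ a.pt n = a.smul (a.pt m) (Fin.partialProd (a.gp m) (σ 0)))
    (hgp : ∀ i, Fin.partialProd (fun j => f ≫ a.gp n j) i =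
      (Fin.partialProd (a.gp m) (σ 0))⁻¹ * Fin.partialProd (a.gp m) (σ i)) :
    f = a.structureMap σ := by
  refine a.hom_ext ?_ fun i => ?_
  · rw [hpt, structureMap, tuple_pt]
  · rw [structureMap, tuple_gp, ← Fin.partialProd_right_inv (fun j => f ≫ a.gp n j) i, hgp, hgp]
    group

theorem eq_structureMap_of_zero {n m : ℕ} (σ : Fin (n + 1) →o Fin (m + 1)) (hσ : σ 0 = 0)
    (f : a.space m ⟶ a.space n) (hpt : f ≫ a.pt n = a.pt m)
    (hgp : ∀ i, Fin.partialProd (fun j => f ≫ a.gp n j) i = Fin.partialProd (a.gp m) (σ i)) :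
    f = a.structureMap σ := by
  refine a.eq_structureMap σ f ?_ fun i => ?_
  · rw [hpt, hσ, Fin.partialProd_zero, smul_one]
  · rw [hgp, hσ, Fin.partialProd_zero, inv_one, _root_.one_mul]

theorem front_eq_structureMap {n p : ℕ} (h : p ≤ n) :
    a.front h = a.structureMap (Fin.castLEOrderEmb (Nat.succ_le_succ h)).toOrderHom := by
  refine a.eq_structureMap_of_zero _ rfl _ (a.tuple_pt _ _) fun i => ?_
  rw [show (fun j => a.front h ≫ a.gp p j) = fun j => a.gp n (Fin.castLE h j) from
    funext (a.tuple_gp _ _), partialProd_castLE]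
  rfl

/-- The inclusion of the last `p + 1` elements of `[n]`, to which the back face map `τ_{n,p}`
belongs. -/
def backEmb {n p : ℕ} (h : p ≤ n) : Fin (p + 1) ↪o Fin (n + 1) :=
  OrderEmbedding.ofStrictMono (fun i => ⟨n - p + i, by omega⟩) fun _ _ hij =>
    Nat.add_lt_add_left hij _

theorem back_eq_structureMap {n p : ℕ} (h : p ≤ n) :
    a.back h = a.structureMap (backEmb h).toOrderHom := by
  refine a.eq_structureMap _ _ (a.tuple_pt _ _) fun i => ?_
  rw [show (fun j => a.back h ≫ a.gp p j) = fun j : Fin p => a.gp n ⟨n - p + j, by omega⟩ from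
    funext (a.tuple_gp _ _), eq_inv_mul_iff_mul_eq]
  exact partialProd_shift (p := p) (q := n - p) (by omega) (a.gp n) i

theorem innerFace_eq_structureMap {n : ℕ} (j : Fin n) :
    a.innerFace j = a.structureMap (Fin.succAboveOrderEmb j.castSucc.succ).toOrderHom := by
  refine a.eq_structureMap_of_zero _ (Fin.succ_succAbove_zero j.castSucc) _
    (a.tuple_pt _ _) fun i => ?_
  rw [show (fun i => a.innerFace j ≫ a.gp n i) =
    Fin.contractNth j.castSucc (· * ·) (a.gp (n + 1)) from funext (a.tuple_gp _ _),
    Fin.partialProd_contractNth]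
  rfl

theorem insertNth_one_eq_partialProd {M : Type*} [Group M] {n : ℕ} (g : Fin n → M)
    (i j : Fin (n + 1)) :
    Fin.insertNth (α := fun _ => M) i 1 g j =
      (Fin.partialProd g (i.predAbove j.castSucc))⁻¹ * Fin.partialProd g (i.predAbove j.succ) := by
  cases j using Fin.succAboveCases i with
  | x => simp
  | p l =>
    rw [Fin.insertNth_apply_succAbove, ← Fin.partialProd_right_inv g l]
    rcases lt_or_ge l.castSucc i with h | h
    · rw [Fin.succAbove_of_castSucc_lt _ _ h, Fin.predAbove_castSucc_of_le _ _ h.le,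
        Fin.succ_castSucc, Fin.predAbove_castSucc_of_le i l.succ (Fin.castSucc_lt_iff_succ_le.1 h)]
    · rw [Fin.succAbove_of_le_castSucc _ _ h, ← Fin.succ_castSucc,
        Fin.predAbove_succ_of_le i l.castSucc h,
        Fin.predAbove_succ_of_le i l.succ (h.trans l.castSucc_lt_succ.le)]

theorem degeneracy_eq_structureMap {n : ℕ} (i : Fin (n + 1)) :
    a.degeneracy i = a.structureMap (Fin.predAboveOrderHom i) := by
  refine congrArg₂ (fun x g => a.tuple x g) ?_
    (funext fun j => insertNth_one_eq_partialProd (a.gp n) i j)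
  rw [show Fin.predAboveOrderHom i 0 = 0 from Fin.predAbove_right_zero (i := i),
    Fin.partialProd_zero, smul_one]

theorem Iic_eq_map_castLEOrderEmb {n : ℕ} (l : Fin (n + 1)) :
    Finset.Iic l = Finset.univ.map (Fin.castLEOrderEmb (Nat.succ_le_of_lt l.2)).toEmbedding := by
  ext x
  simp only [Finset.mem_Iic, Finset.mem_map, Finset.mem_univ, true_and]
  exact ⟨fun h => ⟨⟨x, Nat.lt_succ_of_le h⟩, rfl⟩, by
    rintro ⟨y, rfl⟩
    exact Nat.le_of_lt_succ y.2⟩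

theorem Ici_eq_map_backEmb {n : ℕ} (l : Fin (n + 1)) :
    Finset.Ici l = Finset.univ.map (backEmb (Nat.sub_le n l)).toEmbedding := by
  ext x
  simp only [Finset.mem_Ici, Finset.mem_map, Finset.mem_univ, true_and, Fin.le_def]
  refine ⟨fun h => ⟨⟨x - l, by omega⟩, Fin.ext ?_⟩, ?_⟩
  · change n - (n - l) + (x - l) = (x : ℕ)
    omega
  · rintro ⟨y, rfl⟩
    change (l : ℕ) ≤ n - (n - l) + y
    omega

theorem univ_erase_eq_map_succAboveOrderEmb {n : ℕ} (j : Fin (n + 1)) :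
    Finset.univ.erase j = Finset.univ.map (Fin.succAboveOrderEmb j).toEmbedding := by
  ext x
  simp only [Finset.mem_erase, Finset.mem_univ, and_true, Finset.mem_map, true_and]
  exact Fin.exists_succAbove_eq_iff.symm

theorem sum_erase_zero_erase_last {M : Type*} [AddCommMonoid M] {n : ℕ} (f : Fin (n + 2) → M) :
    ∑ j ∈ (Finset.univ.erase 0).erase (Fin.last (n + 1)), f j = ∑ j : Fin n, f j.castSucc.succ := by
  have h : (Finset.univ.erase 0).erase (Fin.last (n + 1)) =
      Finset.univ.map (Fin.castSuccEmb.trans (Fin.succEmb (n + 1))) := by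
    ext x
    cases x using Fin.cases with
    | zero => simp [Fin.succ_ne_zero]
    | succ x => simp [← Fin.succ_last, Fin.exists_castSucc_eq]
  rw [h, Finset.sum_map]
  rfl

end RightAction

namespace DGCat

variable {k : Type w} [CommRing k]

namespace Coch

variable {B : DGCat.{w, v, u} k} {N q : ℕ} {E F G : Fin (N + 1) → B.Obj}
  (I : Fin (q + 1) →o Fin (N + 1)) {x y : B.Obj}

theorem castHom_diff_apply {m m' : ℤ} (h : m + 1 = m') (θ : Coch B E F m)
    (hx : E (I (Fin.last q)) = x) (hy : F (I 0) = y) :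
    B.castHom hx hy rfl (diff h θ q I) =
      (q : ℤ).negOnePow • B.d (by omega) (B.castHom hx hy rfl (θ q I)) +
        ∑ j ∈ (Finset.univ.erase 0).erase (Fin.last q), ((j : ℕ) : ℤ).negOnePow •
          B.castHom hx hy rfl (θ.ev I (Finset.univ.erase j) 0 (Fin.last q) (m' - q)) := by
  subst hx hy
  rfl

theorem castHom_mul_apply {a b m : ℤ} (h : a + b = m) (θ : Coch B F G a) (η : Coch B E F b)
    (hx : E (I (Fin.last q)) = x) {z : Fin (q + 1) → B.Obj} (hz : ∀ j, F (I j) = z j)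
    (hy : G (I 0) = y) {r : Fin (q + 1) → ℤ}
    (hr : ∀ j : Fin (q + 1), b - ((q : ℤ) - (j : ℕ)) = r j) :
    B.castHom hx hy rfl (mul h θ η q I) =
      ∑ j : Fin (q + 1), ((a - (j : ℕ)) * ((q : ℤ) - (j : ℕ))).negOnePow •
        B.comp (by have := hr j; omega)
          (B.castHom (hz j) hy rfl (θ.ev I (Finset.Iic j) 0 j (a - (j : ℕ))))
          (B.castHom hx (hz j) (hr j)
            (η.ev I (Finset.Ici j) j (Fin.last q) (b - (q - (j : ℕ))))) := by
  obtain rfl : (fun j => F (I j)) = z := funext hz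
  obtain rfl : (fun j : Fin (q + 1) => b - ((q : ℤ) - (j : ℕ))) = r := funext hr
  subst hx hy
  rfl

end Coch

namespace VertexFamily

variable {C : Type u₁} [Category.{v₁} C] [CartesianMonoidalCategory C] {X G : C} [GrpObj G]
  {F : DGPseudoFunctor.{w, v, u, v₁, u₁} k C} {a : RightAction X G} {E E' E'' : (F.rect X).Obj}

section Vertex

variable (U : VertexFamily (B := a.cosimplicial F) E)

theorem obj_last_eq_pull (n : ℕ) :
    U.obj n (Fin.last n) = (F.pull (a.backZero n)).obj E :=
  U.obj_eq n _

theorem obj_zero_eq_pull (n : ℕ) : U.obj n 0 = (F.pull (a.frontZero n)).obj E := by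
  have h : a.frontZero n = a.structureMap (OrderHom.const (Fin 1) 0) :=
    (a.front_eq_structureMap _).trans (congrArg _ (OrderHom.ext _ _ (funext fun i => by
      obtain rfl := Subsingleton.elim i 0
      rfl)))
  rw [h]
  exact U.obj_eq n 0

theorem obj_eq_pull_vertex {n : ℕ} (i : Fin (n + 1)) :
    U.obj n i = (F.pull (a.vertex (Nat.le_of_lt_succ i.2))).obj E :=
  U.obj_eq n i

end Vertex

variable (U : VertexFamily (B := a.cosimplicial F) E) (V : VertexFamily (B := a.cosimplicial F) E')
  (W : VertexFamily (B := a.cosimplicial F) E'')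

/-- A compatible family of cochains on `F̃([X/G]_•)` as the collection of its components at
`0 1 … n`, regarded as morphisms `τ_{n,0}^* E → ρ_{n,0}^* E'`. -/
noncomputable def componentEquiv (m : ℤ) :
    U.compatibleCochains V m ≃ₗ[k] ∀ n : ℕ, DGPseudoFunctor.EqvComponent F a n E E' (m - n) :=
  topEquiv U V m ≪≫ₗ LinearEquiv.piCongrRight fun n =>
    castEquiv (F.rect (a.space n)) (U.obj_last_eq_pull n) (V.obj_zero_eq_pull n) rfl

variable {U V W} {m m' p q : ℤ}

theorem componentEquiv_heq (θ : U.compatibleCochains V m) (n : ℕ) :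
    HEq (componentEquiv U V m θ n) (θ.1 n n OrderHom.id) :=
  castHom_heq (F.rect (a.space n)) _ _ rfl _

theorem componentEquiv_eq_zero_iff (θ : U.compatibleCochains V m) (n : ℕ) :
    componentEquiv U V m θ n = 0 ↔ θ.1 n n OrderHom.id = 0 :=
  castHom_eq_zero_iff (C := F.rect (a.space n)) _ _ rfl

theorem homotopyInvertible_componentEquiv_iff (φ : U.compatibleCochains U 1) :
    (F.rect (a.space 1)).HomotopyInvertible (by simp) (componentEquiv U U 1 φ 1) ↔
      (F.rect (a.space 1)).HomotopyInvertible (by simp) (φ.1 1 1 OrderHom.id) :=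
  homotopyInvertible_castHom_iff (C := F.rect (a.space 1)) _ _ rfl

theorem castHom_apply_eq_pullHom (θ : U.compatibleCochains V m) {n l : ℕ}
    (I : Fin (l + 1) →o Fin (n + 1)) {f : a.space n ⟶ a.space l} (hf : f = a.structureMap I)
    {s t : a.space n ⟶ X} (hs : f ≫ a.backZero l = s) (ht : f ≫ a.frontZero l = t)
    (hx : U.obj n (I (Fin.last l)) = (F.pull s).obj E) (hy : V.obj n (I 0) = (F.pull t).obj E')
    {r : ℤ} (hr : m - l = r) :
    (F.rect (a.space n)).castHom hx hy hr (θ.1 n l I) =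
      (F.rect (a.space n)).castHom rfl rfl hr
        (F.pullHom f hs ht (componentEquiv U V m θ l)) := by
  subst hf
  refine (congrArg _ (apply_eq_pushHom θ.2 n l I)).trans ((castHom_castHom ..).trans ?_)
  refine Eq.trans ?_ (congrArg (fun ξ => (F.rect (a.space n)).castHom rfl rfl hr
    ((F.rect (a.space n)).castHom _ _ rfl ξ))
    (map_castHom (F.pull (a.structureMap I)) (U.obj_last_eq_pull l) (V.obj_zero_eq_pull l) rfl
      (θ.1 l l OrderHom.id)).symm)
  exact ((castHom_castHom ..).trans (castHom_castHom ..)).symm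

theorem castHom_ev_eq_pullHom (θ : U.compatibleCochains V m) {n l : ℕ}
    (e : Fin (l + 1) ↪o Fin (n + 1)) {f : a.space n ⟶ a.space l}
    (hf : f = a.structureMap e.toOrderHom) {s t : a.space n ⟶ X} (hs : f ≫ a.backZero l = s)
    (ht : f ≫ a.frontZero l = t) {A : Finset (Fin (n + 1))} {i j : Fin (n + 1)} {r r' : ℤ}
    (hA : A = Finset.univ.map e.toEmbedding) (hi : i = e 0) (hj : j = e (Fin.last l))
    (hx : U.obj n j = (F.pull s).obj E) (hy : V.obj n i = (F.pull t).obj E') (hr : r + l = m)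
    (hr' : r = r') :
    (F.rect (a.space n)).castHom hx hy hr' ((θ.1 n).ev OrderHom.id A i j r) =
      (F.rect (a.space n)).castHom rfl rfl (by omega)
        (F.pullHom f hs ht (componentEquiv U V m θ l)) := by
  subst hi hj
  rw [(θ.1 n).ev_of OrderHom.id e r hr hA rfl rfl]
  exact (castHom_castHom ..).trans
    (castHom_apply_eq_pullHom θ e.toOrderHom hf hs ht hx hy _)

theorem componentEquiv_diff_zero (h : m + 1 = m') (θ : U.compatibleCochains V m) :
    componentEquiv U V m' ⟨_, diff_mem_compatibleCochains h θ.2⟩ 0 =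
      (F.rect (a.space 0)).d (by omega) (componentEquiv U V m θ 0) :=
  (Coch.castHom_diff_apply (B := F.rect (a.space 0)) OrderHom.id h (θ.1 0) _ _).trans
    ((congrArg₂ (· + ·) (one_smul ℤˣ _) rfl).trans (add_zero _))

theorem componentEquiv_diff_succ (h : m + 1 = m') (θ : U.compatibleCochains V m) (n : ℕ) :
    componentEquiv U V m' ⟨_, diff_mem_compatibleCochains h θ.2⟩ (n + 1) =
      ((n + 1 : ℕ) : ℤ).negOnePow •
        (F.rect (a.space (n + 1))).d (by omega) (componentEquiv U V m θ (n + 1)) +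
      ∑ j : Fin n, ((j + 1 : ℕ) : ℤ).negOnePow •
        (F.rect (a.space (n + 1))).castHom rfl rfl (by push_cast; omega)
          (DGPseudoFunctor.facePull j (componentEquiv U V m θ n)) := by
  refine (Coch.castHom_diff_apply (B := F.rect (a.space (n + 1))) OrderHom.id h
    (θ.1 (n + 1)) _ _).trans
      (congrArg₂ (· + ·) rfl ((RightAction.sum_erase_zero_erase_last _).trans ?_))
  refine Finset.sum_congr rfl fun j _ => congrArg _ ?_
  exact castHom_ev_eq_pullHom θ (Fin.succAboveOrderEmb j.castSucc.succ)
    (a.innerFace_eq_structureMap j) (a.innerFace_back j) (a.innerFace_front j)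
    (RightAction.univ_erase_eq_map_succAboveOrderEmb _) (Fin.succ_succAbove_zero j.castSucc).symm
    (Fin.succAbove_of_le_castSucc _ _ (Nat.succ_le_of_lt j.2)).symm _ _ (by push_cast; omega) rfl

theorem componentEquiv_mul (h : p + q = m) (θ : V.compatibleCochains W p)
    (η : U.compatibleCochains V q) (n : ℕ) :
    componentEquiv U W m ⟨_, mul_mem_compatibleCochains h θ.2 η.2⟩ n =
      ∑ l : Fin (n + 1), ((p - (l : ℕ)) * (n - (l : ℕ)) : ℤ).negOnePow •
        DGPseudoFunctor.cupTerm (by have := l.2; omega) (by have := l.2; omega)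
          (componentEquiv V W p θ l) (componentEquiv U V q η (n - l)) := by
  refine (Coch.castHom_mul_apply (B := F.rect (a.space n)) OrderHom.id h (θ.1 n) (η.1 n) _
    V.obj_eq_pull_vertex _ (r := fun l => q - ((n - l : ℕ) : ℤ)) fun l => by omega).trans
    (Finset.sum_congr rfl fun l _ => congrArg _ ?_)
  have hl := Nat.le_of_lt_succ l.2
  refine congrArg₂ (fun x y => (F.rect (a.space n)).comp _ x y) ?_ ?_
  · exact castHom_ev_eq_pullHom θ (Fin.castLEOrderEmb (Nat.succ_le_of_lt l.2))
      (a.front_eq_structureMap hl) (a.front_back hl) (a.front_front hl)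
      (RightAction.Iic_eq_map_castLEOrderEmb l) rfl rfl _ _ (by omega) rfl
  · exact castHom_ev_eq_pullHom η (RightAction.backEmb (Nat.sub_le n l))
      (a.back_eq_structureMap _) (a.back_back _) (a.back_front (by omega))
      (RightAction.Ici_eq_map_backEmb l)
      (Fin.ext (show (l : ℕ) = n - (n - l) + 0 by omega))
      (Fin.ext (show n = n - (n - l) + (n - l) by omega)) _ _ (by omega) (by omega)

end VertexFamily

end DGCat

namespace DGPseudoFunctor

variable {k : Type w} [CommRing k] {C : Type u₁} [Category.{v₁} C] [CartesianMonoidalCategory C]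
  {X G : C} [GrpObj G] {F : DGPseudoFunctor.{w, v, u, v₁, u₁} k C} {a : RightAction X G}
  {E E' E'' : (F.rect X).Obj}

theorem castHom_cupTerm {n p q q' : ℕ} (h : p + q = n) {r s t t' : ℤ} (hr : r + (s - q) = t)
    (ht : t = t') (hq : q = q') (θ : EqvComponent F a p E' E'' r)
    (η : ∀ n, EqvComponent F a n E E' (s - n)) :
    (F.rect (a.space n)).castHom rfl rfl ht (cupTerm h hr θ (η q)) =
      cupTerm (hq ▸ h) (by rw [← hq, hr, ht]) θ (η q') := by
  subst ht hq; rfl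

theorem cupTerm_eq_zero_of_left {n q : ℕ} (h : 0 + q = n) {r s t : ℤ} (hr : r + s = t)
    {θ : EqvComponent F a 0 E' E'' r} (hθ : θ = 0) (η : EqvComponent F a q E E' s) :
    cupTerm h hr θ η = 0 := by
  simp [cupTerm, hθ]

theorem cupTerm_eq_zero_of_right {n p q : ℕ} (h : p + q = n) {r s t : ℤ} (hr : r + (s - q) = t)
    (θ : EqvComponent F a p E' E'' r) {η : ∀ n, EqvComponent F a n E E' (s - n)} (hη : η 0 = 0)
    (hq : q = 0) : cupTerm h hr θ (η q) = 0 := by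
  subst hq
  simp [cupTerm, hη]

variable {p q m : ℤ} (h : p + q = m)

theorem sum_cupTerm_of_left_zero (θ : ∀ n, EqvComponent F a n E' E'' (p - n))
    (η : ∀ n, EqvComponent F a n E E' (q - n)) (hθ : θ 0 = 0) (n : ℕ) :
    ∑ l : Fin (n + 1), ((p - (l : ℕ)) * (n - (l : ℕ)) : ℤ).negOnePow •
        cupTerm (n := n) (t := m - n) (by have := l.2; omega) (by have := l.2; omega)
          (θ l) (η (n - l)) =
      ∑ l : Fin n, ((p - (l + 1 : ℕ)) * (n - (l + 1 : ℕ)) : ℤ).negOnePow •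
        cupTerm (by have := l.2; omega) (by have := l.2; omega)
          (θ (l + 1)) (η (n - (l + 1))) := by
  refine (Fin.sum_univ_succ _).trans ((congrArg (· + _) ?_).trans (zero_add _))
  exact (congrArg _ (cupTerm_eq_zero_of_left _ _ hθ _)).trans (smul_zero _)

theorem sum_cupTerm_of_right_zero (θ : ∀ n, EqvComponent F a n E' E'' (p - n))
    (η : ∀ n, EqvComponent F a n E E' (q - n)) (hη : η 0 = 0) (n : ℕ) :
    ∑ l : Fin (n + 1), ((p - (l : ℕ)) * (n - (l : ℕ)) : ℤ).negOnePow •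
        cupTerm (n := n) (t := m - n) (by have := l.2; omega) (by have := l.2; omega)
          (θ l) (η (n - l)) =
      ∑ l : Fin n, ((p - (l : ℕ)) * (n - (l : ℕ)) : ℤ).negOnePow •
        cupTerm (by have := l.2; omega) (by have := l.2; omega) (θ l) (η (n - l)) := by
  refine (Fin.sum_univ_castSucc _).trans ((congrArg (_ + ·) ?_).trans (add_zero _))
  exact (congrArg _ (cupTerm_eq_zero_of_right _ _ _ hη (Nat.sub_self n))).trans (smul_zero _)

end DGPseudoFunctor

namespace DGCat.VertexFamily

open DGPseudoFunctor

variable {k : Type w} [CommRing k] {C : Type u₁} [Category.{v₁} C] [CartesianMonoidalCategory C]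
  {X G : C} [GrpObj G] {F : DGPseudoFunctor.{w, v, u, v₁, u₁} k C} {a : RightAction X G}
  {E E' : (F.rect X).Obj} {U : VertexFamily (B := a.cosimplicial F) E}
  {V : VertexFamily (B := a.cosimplicial F) E'}
  (φ : U.compatibleCochains U 1)

theorem componentEquiv_curvature_zero (hφ : componentEquiv U U 1 φ 0 = 0) :
    componentEquiv U U 2 (curvature φ) 0 = 0 := by
  refine (congrFun (map_add (componentEquiv U U 2) _ _) 0).trans ?_
  refine (congrArg₂ (· + ·) ((componentEquiv_diff_zero _ φ).trans
    ((congrArg _ hφ).trans (map_zero _))) ((componentEquiv_mul _ φ φ 0).trans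
    (sum_cupTerm_of_left_zero one_add_one_eq_two _ _ hφ 0))).trans ?_
  exact add_zero _

theorem componentEquiv_curvature_succ (hφ : componentEquiv U U 1 φ 0 = 0) (n : ℕ) :
    componentEquiv U U 2 (curvature φ) (n + 1) =
      (F.rect (a.space (n + 1))).castHom rfl rfl (by push_cast; omega)
        (((n + 1 : ℕ) : ℤ).negOnePow •
            (F.rect (a.space (n + 1))).d (by push_cast; omega) (componentEquiv U U 1 φ (n + 1)) +
          ∑ j : Fin n, ((j + 1 : ℕ) : ℤ).negOnePow • facePull j (componentEquiv U U 1 φ n) +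
          ∑ j : Fin n, ((1 - (j + 1 : ℕ)) * ((n + 1 : ℕ) - (j + 1 : ℕ)) : ℤ).negOnePow •
            cupTerm (by have := j.2; omega) (by have := j.2; omega)
              (componentEquiv U U 1 φ (j + 1)) (componentEquiv U U 1 φ (n - j)) :
          EqvComponent F a (n + 1) E E (1 - n)) := by
  refine (congrFun (map_add (componentEquiv U U 2) _ _) (n + 1)).trans ?_
  refine (congrArg₂ (· + ·) (componentEquiv_diff_succ _ φ n) ((componentEquiv_mul _ φ φ _).trans
    (sum_cupTerm_of_left_zero one_add_one_eq_two _ _ hφ _))).trans ?_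
  simp only [map_add, map_sum, Units.smul_def, map_zsmul, Fin.sum_univ_castSucc]
  refine congrArg₂ (· + ·) (congrArg₂ (· + ·) (congrArg _ ?_) rfl) ?_
  · exact (castHom_d (F.rect (a.space (n + 1))) rfl rfl rfl _ _ _).symm
  refine (congrArg₂ (· + ·) (Finset.sum_congr rfl fun j _ => congrArg _ ?_) ?_).trans (add_zero _)
  · exact (castHom_cupTerm (s := 1) _ _ _ (by simp) _ (componentEquiv U U 1 φ)).symm
  · exact (congrArg _ (cupTerm_eq_zero_of_right _ _ _ hφ (by simp))).trans (smul_zero _)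

variable {φ} in
theorem curvature_eq_zero_iff (hφ : componentEquiv U U 1 φ 0 = 0) :
    curvature φ = 0 ↔ ∀ n : ℕ,
      ((n + 1 : ℕ) : ℤ).negOnePow •
          (F.rect (a.space (n + 1))).d (by push_cast; omega) (componentEquiv U U 1 φ (n + 1)) +
        ∑ j : Fin n, ((j + 1 : ℕ) : ℤ).negOnePow • facePull j (componentEquiv U U 1 φ n) +
        ∑ j : Fin n, ((1 - (j + 1 : ℕ)) * ((n + 1 : ℕ) - (j + 1 : ℕ)) : ℤ).negOnePow •
          cupTerm (by have := j.2; omega) (by have := j.2; omega)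
            (componentEquiv U U 1 φ (j + 1)) (componentEquiv U U 1 φ (n - j)) =
      (0 : EqvComponent F a (n + 1) E E (1 - n)) := by
  rw [← (componentEquiv U U 2).map_eq_zero_iff, funext_iff]
  refine ⟨fun h n => ?_, fun h n => ?_⟩
  · exact (castHom_eq_zero_iff rfl rfl _).1
      ((componentEquiv_curvature_succ φ hφ n).symm.trans (h (n + 1)))
  · cases n with
    | zero => exact componentEquiv_curvature_zero φ hφ
    | succ n =>
      exact (componentEquiv_curvature_succ φ hφ n).trans ((congrArg _ (h n)).trans (map_zero _))

theorem apply_const_eq_id_iff :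
    φ.1 0 1 (OrderHom.const _ 0) = (F.rect (a.space 0)).castHom rfl rfl (by simp)
        ((F.rect (a.space 0)).id (U.obj 0 0)) ↔
      F.pullHom (a.degeneracy (n := 0) 0) a.degeneracy_back a.degeneracy_front
          (componentEquiv U U 1 φ 1) =
        (F.rect X).castHom rfl rfl (by simp) ((F.rect X).id ((F.pull (𝟙 X)).obj E)) := by
  have hf : a.degeneracy (n := 0) 0 = a.structureMap (OrderHom.const (Fin 2) 0) :=
    (a.degeneracy_eq_structureMap 0).trans
      (congrArg _ (OrderHom.ext _ _ (funext fun _ => Subsingleton.elim (α := Fin 1) _ _)))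
  have hU : U.obj 0 0 = (F.pull (𝟙 X)).obj E :=
    U.obj_zero_eq_pull 0
  refine (castHom_inj (C := F.rect X) hU hU rfl).symm.trans (iff_of_eq (congrArg₂ (· = ·)
    (castHom_apply_eq_pullHom φ _ hf a.degeneracy_back a.degeneracy_front hU hU rfl)
    (castHom_castHom_id (F.rect X) hU hU _)))

theorem apply_predAbove_eq_zero_iff {m : ℤ} (θ : U.compatibleCochains V m) {n : ℕ}
    (i : Fin (n + 1)) :
    θ.1 n (n + 1) (Fin.predAboveOrderHom i) = 0 ↔
      (F.pull (a.degeneracy i)).map (componentEquiv U V m θ (n + 1)) = 0 := by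
  rw [a.degeneracy_eq_structureMap]
  refine ((iff_of_eq (congrArg (· = 0) (apply_eq_pushHom θ.2 n (n + 1) _))).trans
    (castHom_eq_zero_iff ..)).trans ?_
  refine (castHom_eq_zero_iff (C := F.rect (a.space n)) _ _ _).symm.trans
    (iff_of_eq (congrArg (· = 0) (map_castHom (F.pull (a.structureMap _))
      (U.obj_last_eq_pull (n + 1)) (V.obj_zero_eq_pull (n + 1)) rfl _).symm))

end DGCat.VertexFamily

namespace DGPseudoFunctor

variable {k : Type w} [CommRing k] {C : Type u₁} [Category.{v₁} C] [CartesianMonoidalCategory C]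
  {X G : C} [GrpObj G] {F : DGPseudoFunctor.{w, v, u, v₁, u₁} k C} {a : RightAction X G}
  {c : DegeneracyConvention}

namespace EqvObj

theorem ext_of_heq {e e' : EqvObj F a c} (hE : e.E = e'.E)
    (hφ : ∀ (n : ℕ) (hn : 1 ≤ n), HEq (e.φ n hn) (e'.φ n hn)) : e = e' := by
  obtain ⟨E, φ, _, _, _⟩ := e
  obtain ⟨E', φ', _, _, _⟩ := e'
  obtain rfl : E = E' := hE
  obtain rfl : φ = φ' := funext fun n => funext fun hn => eq_of_heq (hφ n hn)
  rfl

/-- The components `φ^{n,1-n}` of an equivariant twisted object for all `n ≥ 0`, with `φ^{0,1} = 0`,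
so that they are the components of a cochain. -/
def extendedφ (e : EqvObj F a c) : ∀ n : ℕ, EqvComponent F a n e.E e.E (1 - n)
  | 0 => 0
  | n + 1 => e.φ (n + 1) (by omega)

theorem φ_eq_extendedφ (e : EqvObj F a c) : ∀ {n : ℕ} (hn : 1 ≤ n), e.φ n hn = e.extendedφ n
  | _ + 1, _ => rfl

end EqvObj

end DGPseudoFunctor

namespace DGCat.Tot

open VertexFamily DGPseudoFunctor

variable {k : Type w} [CommRing k] {C : Type u₁} [Category.{v₁} C] [CartesianMonoidalCategory C]
  {X G : C} [GrpObj G] {F : DGPseudoFunctor.{w, v, u, v₁, u₁} k C} {a : RightAction X G}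
  {c : DegeneracyConvention}

theorem componentEquiv_twistingCochain_zero (x : (Tot c (a.cosimplicial F)).Obj) :
    componentEquiv (vertexFamily x) (vertexFamily x) 1 (twistingCochain x) 0 = 0 :=
  (componentEquiv_eq_zero_iff (twistingCochain x) 0).2 ((component x 0).φ_zero _)

/-- The equivariant twisted object on `X` with the components at `0 1 … n` of an object of the
totalization. -/
noncomputable def toEqvObj (x : (Tot c (a.cosimplicial F)).Obj) : EqvObj F a c where
  E := (component x 0).E 0
  φ n _ := componentEquiv (vertexFamily x) (vertexFamily x) 1 (twistingCochain x) n
  maurerCartan := (curvature_eq_zero_iff (componentEquiv_twistingCochain_zero x)).1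
    (Subtype.ext (funext fun n => (component x n).maurerCartan))
  nondegenerate := (homotopyInvertible_componentEquiv_iff (twistingCochain x)).2
    ((component x 1).invertible OrderHom.id)
  normalized hc := by
    refine ⟨(apply_const_eq_id_iff (twistingCochain x)).1
      (((component x 0).normalized hc).1 (OrderHom.const _ 0) rfl), fun n i => ?_⟩
    refine (apply_predAbove_eq_zero_iff (twistingCochain x) i).1
      (((component x (n + 1)).normalized hc).2 (n + 2) _ (by omega) fun hinj => ?_)
    simpa using Fintype.card_le_of_injective _ hinj

theorem toEqvObj_φ_heq (x : (Tot c (a.cosimplicial F)).Obj) (n : ℕ) (hn : 1 ≤ n) :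
    HEq ((toEqvObj x).φ n hn) ((component x n).φ n OrderHom.id) :=
  componentEquiv_heq (twistingCochain x) n

theorem toEqvObj_injective :
    Function.Injective (toEqvObj : (Tot c (a.cosimplicial F)).Obj → EqvObj F a c) := by
  intro x y h
  have hφ : ∀ (n : ℕ) (hn : 1 ≤ n), HEq ((toEqvObj x).φ n hn) ((toEqvObj y).φ n hn) := by
    rw [h]; exact fun _ _ => HEq.rfl
  have hE : (component x 0).E 0 = (component y 0).E 0 :=
    congrArg EqvObj.E h
  exact ext hE fun n hn =>
    (toEqvObj_φ_heq x n hn).symm.trans ((hφ n hn).trans (toEqvObj_φ_heq y n hn))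

theorem toEqvObj_surjective :
    Function.Surjective (toEqvObj : (Tot c (a.cosimplicial F)).Obj → EqvObj F a c) := by
  intro e
  let U : VertexFamily (B := a.cosimplicial F) e.E :=
    standard (B := a.cosimplicial F) e.E
  obtain ⟨φ, hφ⟩ := (componentEquiv U U 1).surjective e.extendedφ
  have hφ' : ∀ (n : ℕ) (hn : 1 ≤ n), e.φ n hn = componentEquiv U U 1 φ n := fun n hn =>
    (e.φ_eq_extendedφ hn).trans (congrFun hφ n).symm
  have hφ₀ : componentEquiv U U 1 φ 0 = 0 := congrFun hφ 0
  refine ⟨Tot.mk U φ ((componentEquiv_eq_zero_iff φ 0).1 hφ₀)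
    ((curvature_eq_zero_iff hφ₀).2 fun n => ?_) ?_ fun hc => ⟨?_, fun n i => ?_⟩, ?_⟩
  · simpa only [hφ'] using e.maurerCartan n
  · exact (homotopyInvertible_componentEquiv_iff φ).1 (hφ' 1 le_rfl ▸ e.nondegenerate)
  · exact (apply_const_eq_id_iff φ).2 (hφ' 1 le_rfl ▸ (e.normalized hc).1)
  · exact (apply_predAbove_eq_zero_iff φ i).2 (hφ' (n + 2) _ ▸ (e.normalized hc).2 n i)
  · refine EqvObj.ext_of_heq ?_ fun n hn => ?_
    · exact U.obj_zero_zero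
    · exact (toEqvObj_φ_heq _ n hn).trans
        ((componentEquiv_heq φ n).symm.trans (heq_of_eq (hφ' n hn).symm))

/-- The components at `0 1 … n` of the morphisms of the totalization, as an isomorphism onto the
morphisms of equivariant twisted objects. -/
noncomputable def eqvHomEquiv (x y : (Tot c (a.cosimplicial F)).Obj) (m : ℤ) :
    (Tot c (a.cosimplicial F)).Hom x y m ≃ₗ[k] EqvHom (toEqvObj x) (toEqvObj y) m :=
  homEquiv x y m ≪≫ₗ componentEquiv (vertexFamily x) (vertexFamily y) m

variable {x y z : (Tot c (a.cosimplicial F)).Obj} {m m' p q : ℤ}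

theorem eqvHomEquiv_comp (h : p + q = m) (θ : (Tot c (a.cosimplicial F)).Hom y z p)
    (η : (Tot c (a.cosimplicial F)).Hom x y q) :
    eqvHomEquiv x z m ((Tot c (a.cosimplicial F)).comp h θ η) =
      EqvHom.comp h (eqvHomEquiv y z p θ) (eqvHomEquiv x y q η) :=
  funext fun n => componentEquiv_mul h (homEquiv y z p θ) (homEquiv x y q η) n

theorem eqvHomEquiv_id (x : (Tot c (a.cosimplicial F)).Obj) :
    eqvHomEquiv x x 0 ((Tot c (a.cosimplicial F)).id x) = EqvHom.id (toEqvObj x) := by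
  funext n
  cases n with
  | zero =>
    exact castHom_castHom_id (F.rect X) ((vertexFamily x).obj_last_eq_pull 0)
      ((vertexFamily x).obj_zero_eq_pull 0) (by simp)
  | succ n => exact (componentEquiv_eq_zero_iff (homEquiv x x 0 _) (n + 1)).2 rfl

theorem componentEquiv_diff_eq (h : m + 1 = m') (θ : (Tot c (a.cosimplicial F)).Hom x y m)
    (n : ℕ) :
    componentEquiv (vertexFamily x) (vertexFamily y) m'
        ⟨_, diff_mem_compatibleCochains h (homEquiv x y m θ).2⟩ n =
      (n : ℤ).negOnePow • (F.rect (a.space n)).d (by omega) (eqvHomEquiv x y m θ n) +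
        EqvHom.faceSum h (eqvHomEquiv x y m θ) n := by
  cases n with
  | zero =>
    refine (componentEquiv_diff_zero h (homEquiv x y m θ)).trans ?_
    exact ((one_smul ℤˣ _).symm.trans (congrArg (· • _) Int.negOnePow_zero.symm)).trans
      (add_zero _).symm
  | succ n => exact componentEquiv_diff_succ h (homEquiv x y m θ) n

theorem eqvHomEquiv_d (h : m + 1 = m') (θ : (Tot c (a.cosimplicial F)).Hom x y m) :
    eqvHomEquiv x y m' ((Tot c (a.cosimplicial F)).d h θ) =
      EqvHom.d h (eqvHomEquiv x y m θ) := by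
  have h' : 1 + m = m' := (add_comm 1 m).trans h
  let θ' := homEquiv x y m θ
  let ψθ : (vertexFamily x).compatibleCochains (vertexFamily y) m' :=
    ⟨_, mul_mem_compatibleCochains h' (twistingCochain y).2 θ'.2⟩
  let θφ : (vertexFamily x).compatibleCochains (vertexFamily y) m' :=
    ⟨_, mul_mem_compatibleCochains h θ'.2 (twistingCochain x).2⟩
  have hd : homEquiv x y m' ((Tot c (a.cosimplicial F)).d h θ) =
      ⟨_, diff_mem_compatibleCochains h θ'.2⟩ + ψθ - m.negOnePow • θφ := rfl
  funext n
  refine (congrFun (congrArg (componentEquiv _ _ m') hd) n).trans ?_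
  simp only [Units.smul_def, map_sub, map_add, map_zsmul]
  refine congrArg₂ (· - ·) (congrArg₂ (· + ·) (componentEquiv_diff_eq h θ n) ?_)
    (congrArg (m.negOnePow • ·) ?_)
  · exact (componentEquiv_mul h' (twistingCochain y) θ' n).trans
      (sum_cupTerm_of_left_zero h' _ _ (componentEquiv_twistingCochain_zero y) n)
  · exact (componentEquiv_mul h θ' (twistingCochain x) n).trans
      (sum_cupTerm_of_right_zero h _ _ (componentEquiv_twistingCochain_zero x) n)

end DGCat.Tot

theorem proposition12_general {k : Type w} [CommRing k] {C : Type u₁} [Category.{v₁} C]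
    [CartesianMonoidalCategory C] {X G : C} [GrpObj G]
    (a : RightAction X G) (F : DGPseudoFunctor.{w, v, u, v₁, u₁} k C)
    (c : DegeneracyConvention) :
    ∃ (Φ : (DGCat.Tot c (a.cosimplicial F)).Obj ≃ DGPseudoFunctor.EqvObj F a c)
      (Ψ : ∀ (x y : (DGCat.Tot c (a.cosimplicial F)).Obj) (m : ℤ),
        (DGCat.Tot c (a.cosimplicial F)).Hom x y m ≃ₗ[k]
          DGPseudoFunctor.EqvHom (Φ x) (Φ y) m),
      (∀ x, (Φ x).E = (DGCat.Tot.component x 0).E 0) ∧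
      (∀ x (n : ℕ) (hn : 1 ≤ n),
        HEq ((Φ x).φ n hn) ((DGCat.Tot.component x n).φ n OrderHom.id)) ∧
      (∀ x y m θ (n : ℕ), HEq (Ψ x y m θ n) (DGCat.Tot.homComponent θ n n OrderHom.id)) ∧
      (∀ x y (m m' : ℤ) (h : m + 1 = m') θ,
        Ψ x y m' ((DGCat.Tot c (a.cosimplicial F)).d h θ) =
          DGPseudoFunctor.EqvHom.d h (Ψ x y m θ)) ∧
      (∀ x y z (p q m : ℤ) (h : p + q = m) θ η,
        Ψ x z m ((DGCat.Tot c (a.cosimplicial F)).comp h θ η) =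
          DGPseudoFunctor.EqvHom.comp h (Ψ y z p θ) (Ψ x y q η)) ∧
      (∀ x, Ψ x x 0 ((DGCat.Tot c (a.cosimplicial F)).id x) =
        DGPseudoFunctor.EqvHom.id (Φ x)) :=
  ⟨Equiv.ofBijective DGCat.Tot.toEqvObj
      ⟨DGCat.Tot.toEqvObj_injective, DGCat.Tot.toEqvObj_surjective⟩,
    DGCat.Tot.eqvHomEquiv,
    fun _ => rfl,
    DGCat.Tot.toEqvObj_φ_heq,
    fun x y m θ n => DGCat.VertexFamily.componentEquiv_heq (DGCat.Tot.homEquiv x y m θ) n,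
    fun _ _ _ _ h θ => DGCat.Tot.eqvHomEquiv_d h θ,
    fun _ _ _ _ _ _ h θ η => DGCat.Tot.eqvHomEquiv_comp h θ η,
    DGCat.Tot.eqvHomEquiv_id⟩

theorem proposition12 {k : Type w} [CommRing k] {S : AlgebraicGeometry.Scheme.{u₁}} {X G : Over S} [GrpObj G]
    (a : RightAction X G) (F : DGPseudoFunctor.{w, v, u} k (Over S))
    (c : DegeneracyConvention) :
    ∃ (Φ : (DGCat.Tot c (a.cosimplicial F)).Obj ≃ DGPseudoFunctor.EqvObj F a c)
      (Ψ : ∀ (x y : (DGCat.Tot c (a.cosimplicial F)).Obj) (m : ℤ),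
        (DGCat.Tot c (a.cosimplicial F)).Hom x y m ≃ₗ[k]
          DGPseudoFunctor.EqvHom (Φ x) (Φ y) m),
      (∀ x, (Φ x).E = (DGCat.Tot.component x 0).E 0) ∧
      (∀ x (n : ℕ) (hn : 1 ≤ n),
        HEq ((Φ x).φ n hn) ((DGCat.Tot.component x n).φ n OrderHom.id)) ∧
      (∀ x y m θ (n : ℕ), HEq (Ψ x y m θ n) (DGCat.Tot.homComponent θ n n OrderHom.id)) ∧
      (∀ x y (m m' : ℤ) (h : m + 1 = m') θ,
        Ψ x y m' ((DGCat.Tot c (a.cosimplicial F)).d h θ) =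
          DGPseudoFunctor.EqvHom.d h (Ψ x y m θ)) ∧
      (∀ x y z (p q m : ℤ) (h : p + q = m) θ η,
        Ψ x z m ((DGCat.Tot c (a.cosimplicial F)).comp h θ η) =
          DGPseudoFunctor.EqvHom.comp h (Ψ y z p θ) (Ψ x y q η)) ∧
      (∀ x, Ψ x x 0 ((DGCat.Tot c (a.cosimplicial F)).id x) =
        DGPseudoFunctor.EqvHom.id (Φ x)) :=
  proposition12_general a F c
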